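/- **Setting.** Let $n\ge 1$ and let $(M',J,g')$ be a Kähler manifold with Norden metric, $\dim M'=2n+2$: $g'$ is a pseudo-Riemannian metric, $J$ an almost complex structure, $g'(JX,JY)=-g'(X,Y)$ and $\nabla'J=0$ for the Levi-Civita connection $\nabla'$ of $g'$. Curvature tensors are $R(X,Y)Z=\nabla_X\nabla_YZ-\nabla_Y\nabla_XZ-\nabla_{[X,Y]}Z$, $R(x,y,z,u)=g(R(x,y)z,u)$. Let $M'$ be of constant totally real sectional curvatures $\nu',\tilde\nu'$ (functions on $M'$): for all $q\in M'$ and every nondegenerate section with basis $\{x,y\}$ in $T_qM'$ that is orthogonal to its image under $J$, $$\frac{R'(x,y,y,x)}{\pi_1'(x,y,y,x)}=\nu'(q),\qquad \frac{R'(x,y,y,Jx)}{\pi_1'(x,y,y,x)}=\tilde\nu'(q),$$ where $\pi'_1(x,y,z,u)=g'(y,z)g'(x,u)-g'(x,z)g'(y,u)$. Let $M$ be a real time-like hypersurface of $M'$: an immersed hypersurface with a smooth unit normal $N$, $g'(N,N)=-1$, equipped with $t=\arctan g'(N,JN)\in(-\frac\pi2,\frac\pi2)$ and $$\varphi=J+\cos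 t\, g'(\cdot,JN)\{\cos t\,N-\sin t\,JN\},\quad \xi=\sin t\,N+\cos t\,JN,\quad \eta=\cos t\,g'(\cdot,JN),\quad g=g'|_M .$$ Let $\nabla$ and $R$ be the Levi-Civita connection and the curvature tensor of $g$, and let $F(x,y,z)=g((\nabla_x\varphi)y,z)$, $\theta(z)=g^{ij}F(e_i,e_j,z)$, $\theta^*(z)=g^{ij}F(e_i,\varphi e_j,z)$, where $\{e_1,\dots,e_{2n},\xi\}$ is a basis of $T_pM$ with $e_i\perp\xi$. Define $$\begin{aligned} \pi_1(x,y,z,u)&=g(y,z)g(x,u)-g(x,z)g(y,u),\\ \pi_2(x,y,z,u)&=g(y,\varphi z)g(x,\varphi u)-g(x,\varphi z)g(y,\varphi u),\\ \pi_3(x,y,z,u)&=-g(y,z)g(x,\varphi u)+g(x,z)g(y,\varphi u)-g(y,\varphi z)g(x,u)+g(x,\varphi z)g(y,u),\\ \pi_4(x,y,z,u)&=\eta(y)\eta(z)g(x,u)-\eta(x)\eta(z)g(y,u)+\eta(x)\eta(u)g(y,z)-\eta(y)\eta(u)g(x,z),\\ \pi_5(x,y,z,u)&=\eta(y)\eta(z)g(x,\varphi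 u)-\eta(x)\eta(z)g(y,\varphi u)+\eta(x)\eta(u)g(y,\varphi z)-\eta(y)\eta(u)g(x,\varphi z). \end{aligned}$$ Let $k(x,y)=R(x,y,y,x)/\pi_1(x,y,y,x)$ for nondegenerate sections, let $\tau=g^{ij}g^{kl}R(e_i,e_k,e_l,e_j)$ and $\tilde\tau=g^{ij}g^{kl}R(e_i,e_k,e_l,\varphi e_j)$ (contractions over a basis of the whole of $T_pM$). **Corollary 3.1.** Suppose that $M$ is an $\mathcal F_4\oplus\mathcal F_5$-manifold, i.e. $$F(x,y,z)=-\tfrac{\theta(\xi)}{2n}\{g(\varphi x,\varphi y)\eta(z)+g(\varphi x,\varphi z)\eta(y)\}-\tfrac{\theta^*(\xi)}{2n}\{g(x,\varphi y)\eta(z)+g(x,\varphi z)\eta(y)\}.$$ Then, at every point of $M$ (with $\nu',\tilde\nu'$ taken at its image in $M'$), $$\begin{aligned} R={}&\nu'[\pi_1-\pi_2-\tan t\,\pi_5]+\tilde\nu'[\pi_3-\tan t\,\pi_4]\\ &-\frac{dt(\xi)}{4n\cos t}\{\theta(\xi)[\sin t\,\pi_5+\cos t\,\pi_4]+\theta^*(\xi)[\sin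 t\,\pi_4-\cos t\,\pi_5]\}\\ &-\frac{\theta(\xi)^2+\theta^*(\xi)^2}{4n^2}\pi_2-\frac{(\theta(\xi)\cos t+\theta^*(\xi)\sin t)^2}{4n^2}[\pi_1-\pi_2-\pi_4]\\ &+\frac{(\theta(\xi)\cos t+\theta^*(\xi)\sin t)(\theta(\xi)\sin t-\theta^*(\xi)\cos t)}{4n^2}[\pi_3+\pi_5],\\ \tau={}&4n(n\nu'-\tilde\nu'\tan t)-dt(\xi)\theta(\xi)-dt(\xi)\theta^*(\xi)\tan t\\ &-\frac{n-1}{n}(\theta(\xi)\cos t+\theta^*(\xi)\sin t)^2-\frac{\theta(\xi)^2+\theta^*(\xi)^2}{2n},\\ \tilde\tau={}&2n(2n-1)\tilde\nu'+2n\nu'\tan t+\frac{dt(\xi)\theta(\xi)}{2}\tan t-\frac{dt(\xi)\theta^*(\xi)}{2}\\ &+\frac{n-1}{n}(\theta(\xi)\sin t-\theta^*(\xi)\cos t)(\theta(\xi)\cos t+\theta^*(\xi)\sin t). \end{aligned}$$ Moreover, every nondegenerate $\varphi$-holomorphic section $\alpha=\varphi\alpha$ (in particular each nondegenerate section $\{\varphi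 x,\varphi^2x\}$) has sectional curvature $$k=-\frac{\theta(\xi)^2+\theta^*(\xi)^2}{4n^2},$$ and every nondegenerate totally real section $\{x,y\}$ (i.e. one orthogonal to its image under $\varphi$) that is orthogonal to $\xi$ has sectional curvature $$k(x,y)=\nu'-\frac{(\theta(\xi)\cos t+\theta^*(\xi)\sin t)^2}{4n^2}.$$ -/

import Mathlib

open scoped Manifold ContDiff

noncomputable section

namespace Norden

/-! ## Algebra in one tangent space -/

section Algebra

variable {E : Type*} [NormedAddCommGroup E] [NormedSpace ℝ E]

/-- Raising an index with a nondegenerate bilinear form `G` on a finite-dimensional space: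
`sharp G l` is the vector `v` with `G v w = l w` for all `w`. -/
def sharp (G : E →L[ℝ] E →L[ℝ] ℝ) : (E →L[ℝ] ℝ) →L[ℝ] E :=
  ContinuousLinearMap.inverse G

/-- The metric contraction `g^{ij} B(e_i, e_j)`, where `(g^{ij})` is the inverse of the Gram
matrix of `G` in a basis `e`.  For bilinear `B` it does not depend on `e`. -/
def contract [FiniteDimensional ℝ E] (G : E →L[ℝ] E →L[ℝ] ℝ) (B : E → E → ℝ) : ℝ :=
  let e := Module.finBasis ℝ E
  ∑ i, ∑ j, (Matrix.of fun k l => G (e k) (e l))⁻¹ i j * B (e i) (e j)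

/-- The contraction `g^{ij} B(e_i, e_j)` over a basis `e_1, …, e_{2n}` of the orthogonal
complement of a vector `ξ` with `G ξ ξ = 1`. -/
def contractPerp [FiniteDimensional ℝ E] (G : E →L[ℝ] E →L[ℝ] ℝ) (ξ : E)
    (B : E → E → ℝ) : ℝ :=
  contract G B - B ξ ξ

variable (G : E →L[ℝ] E →L[ℝ] ℝ) (Φ : E →L[ℝ] E) (η : E →L[ℝ] ℝ) (x y z u : E)

/-- `π₁(x, y, z, u)`. -/
def pi1 : ℝ := G y z * G x u - G x z * G y u

/-- `π₂(x, y, z, u)`. -/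
def pi2 : ℝ := G y (Φ z) * G x (Φ u) - G x (Φ z) * G y (Φ u)

/-- `π₃(x, y, z, u)`. -/
def pi3 : ℝ :=
  -(G y z * G x (Φ u)) + G x z * G y (Φ u) - G y (Φ z) * G x u + G x (Φ z) * G y u

/-- `π₄(x, y, z, u)`. -/
def pi4 : ℝ :=
  η y * η z * G x u - η x * η z * G y u + η x * η u * G y z - η y * η u * G x z

/-- `π₅(x, y, z, u)`. -/
def pi5 : ℝ :=
  η y * η z * G x (Φ u) - η x * η z * G y (Φ u) + η x * η u * G y (Φ z)
    - η y * η u * G x (Φ z)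

/-- The section spanned by `x, y` is nondegenerate; in particular `x, y` are independent. -/
def IsNondegenerateSection : Prop := pi1 G x y y x ≠ 0

/-- The section `α` spanned by `x, y` is totally real: `Φ α` is orthogonal to `α`. -/
def IsTotallyRealSection : Prop :=
  G (Φ x) x = 0 ∧ G (Φ x) y = 0 ∧ G (Φ y) x = 0 ∧ G (Φ y) y = 0

/-- The section `α` spanned by `x, y` is holomorphic with respect to `Φ`: `Φ α = α`. -/
def IsHolomorphicSection : Prop :=
  (Submodule.span ℝ {x, y}).map Φ.toLinearMap = Submodule.span ℝ {x, y}

/-- The sectional curvature `R(x, y, y, x) / π₁(x, y, y, x)` of a tensor `R` of type `(0,4)`. -/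
def sectional (R : E → E → E → E → ℝ) : ℝ := R x y y x / pi1 G x y y x

/-- The scalar curvature `g^{ij} g^{kl} R(e_i, e_k, e_l, e_j)` of a tensor `R` of
type `(0,4)`. -/
def scalar [FiniteDimensional ℝ E] (R : E → E → E → E → ℝ) : ℝ :=
  contract G fun b c => contract G fun a d => R a b c d

end Algebra

/-! ## The Levi-Civita connection in coordinates

`G : E → E →L[ℝ] E →L[ℝ] ℝ` is a metric given in coordinates, `y` is a point of the coordinate
space, and vectors are vectors of the coordinate space. -/

section Coordinates

variable {E : Type*} [NormedAddCommGroup E] [NormedSpace ℝ E]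

/-- The Christoffel symbol `Γ_y(v, w)`, characterized by
`2 G_y(Γ_y(v, w), u) = ∂_v G(w, u) + ∂_w G(v, u) - ∂_u G(v, w)`.
In coordinates `∇_v W = ∂_v W + Γ(v, W)`. -/
def christoffel (G : E → E →L[ℝ] E →L[ℝ] ℝ) (y v w : E) : E :=
  sharp (G y) ((1 / 2 : ℝ) •
    (fderiv ℝ G y v w + fderiv ℝ G y w v - ((fderiv ℝ G y).flip v).flip w))

/-- `R(v, w)z = ∇_v ∇_w z - ∇_w ∇_v z` for constant coordinate fields `v, w, z`. -/
def coordCurvature (G : E → E →L[ℝ] E →L[ℝ] ℝ) (y v w z : E) : E :=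
  fderiv ℝ (fun y' => christoffel G y' w z) y v - fderiv ℝ (fun y' => christoffel G y' v z) y w
    + christoffel G y v (christoffel G y w z) - christoffel G y w (christoffel G y v z)

/-- `(∇_v Φ) w = ∇_v (Φ w) - Φ (∇_v w)` for an endomorphism field `Φ` and constant coordinate
fields `v, w`. -/
def coordCovDeriv (G : E → E →L[ℝ] E →L[ℝ] ℝ) (Φ : E → E →L[ℝ] E) (y v w : E) : E :=
  fderiv ℝ Φ y v w + christoffel G y v (Φ y w) - Φ y (christoffel G y v w)

end Coordinates

/-! ## Tensor fields on a manifold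

In Mathlib `TangentSpace 𝓘(ℝ, E) p` is the model space `E`, a tangent vector at `p` being
identified with its coordinates in the preferred chart at `p`.  The curvature and the covariant
derivative at `p`, which are tensors, are therefore computed in the chart at `p`. -/

section Manifolds

variable {E : Type*} [NormedAddCommGroup E] [NormedSpace ℝ E]
  {M : Type*} [TopologicalSpace M] [ChartedSpace E M]

/-- The coordinate frame of the chart at `p`: the derivative of the inverse chart at the
coordinate point `y`. -/
def frame (p : M) (y : E) :
    E →L[ℝ] TangentSpace 𝓘(ℝ, E) ((extChartAt 𝓘(ℝ, E) p).symm y) :=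
  mfderiv 𝓘(ℝ, E) 𝓘(ℝ, E) (extChartAt 𝓘(ℝ, E) p).symm y

/-- The components, in the chart at `p`, of a field of bilinear forms. -/
def bilinInChart
    (g : ∀ q : M, TangentSpace 𝓘(ℝ, E) q →L[ℝ] TangentSpace 𝓘(ℝ, E) q →L[ℝ] ℝ)
    (p : M) (y : E) : E →L[ℝ] E →L[ℝ] ℝ :=
  ContinuousLinearMap.bilinearComp (E := E) (F := E) (E' := E) (F' := E)
    (g ((extChartAt 𝓘(ℝ, E) p).symm y)) (frame p y) (frame p y)

/-- The components, in the chart at `p`, of a field of endomorphisms. -/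
def endoInChart
    (Φ : ∀ q : M, TangentSpace 𝓘(ℝ, E) q →L[ℝ] TangentSpace 𝓘(ℝ, E) q)
    (p : M) (y : E) : E →L[ℝ] E :=
  (mfderiv 𝓘(ℝ, E) 𝓘(ℝ, E) (extChartAt 𝓘(ℝ, E) p) ((extChartAt 𝓘(ℝ, E) p).symm y)).comp
    ((Φ ((extChartAt 𝓘(ℝ, E) p).symm y)).comp (frame p y))

/-- The curvature operator `R(x, y)z` at `p` of the Levi-Civita connection of `g`. -/
def curvature
    (g : ∀ q : M, TangentSpace 𝓘(ℝ, E) q →L[ℝ] TangentSpace 𝓘(ℝ, E) q →L[ℝ] ℝ)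
    (p : M) (x y z : TangentSpace 𝓘(ℝ, E) p) : TangentSpace 𝓘(ℝ, E) p :=
  coordCurvature (E := E) (bilinInChart g p) (extChartAt 𝓘(ℝ, E) p p) x y z

/-- The curvature tensor `R(x, y, z, u) = g(R(x, y)z, u)` at `p`. -/
def curvature4
    (g : ∀ q : M, TangentSpace 𝓘(ℝ, E) q →L[ℝ] TangentSpace 𝓘(ℝ, E) q →L[ℝ] ℝ)
    (p : M) (x y z u : TangentSpace 𝓘(ℝ, E) p) : ℝ :=
  g p (curvature g p x y z) u

/-- The covariant derivative `(∇_x Φ) y` at `p`, with `∇` the Levi-Civita connection of `g`. -/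
def covDeriv
    (g : ∀ q : M, TangentSpace 𝓘(ℝ, E) q →L[ℝ] TangentSpace 𝓘(ℝ, E) q →L[ℝ] ℝ)
    (Φ : ∀ q : M, TangentSpace 𝓘(ℝ, E) q →L[ℝ] TangentSpace 𝓘(ℝ, E) q)
    (p : M) (x y : TangentSpace 𝓘(ℝ, E) p) : TangentSpace 𝓘(ℝ, E) p :=
  coordCovDeriv (E := E) (bilinInChart g p) (endoInChart Φ p) (extChartAt 𝓘(ℝ, E) p p) x y

end Manifolds

/-- A Kähler manifold with Norden metric, modelled on `E`: a smooth pseudo-Riemannian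
metric `g` and a smooth almost complex structure `J` with `g(JX, JY) = -g(X, Y)` and `∇J = 0`. -/
structure KahlerNorden (E : Type*) [NormedAddCommGroup E] [NormedSpace ℝ E]
    (M : Type*) [TopologicalSpace M] [ChartedSpace E M] where
  g : ∀ q : M, TangentSpace 𝓘(ℝ, E) q →L[ℝ] TangentSpace 𝓘(ℝ, E) q →L[ℝ] ℝ
  J : ∀ q : M, TangentSpace 𝓘(ℝ, E) q →L[ℝ] TangentSpace 𝓘(ℝ, E) q
  smooth_g : ∀ p : M, ContDiffOn ℝ ∞ (bilinInChart g p) (extChartAt 𝓘(ℝ, E) p).target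
  smooth_J : ∀ p : M, ContDiffOn ℝ ∞ (endoInChart J p) (extChartAt 𝓘(ℝ, E) p).target
  symm : ∀ (q : M) (v w : TangentSpace 𝓘(ℝ, E) q), g q v w = g q w v
  nondegenerate : ∀ (q : M) (v : TangentSpace 𝓘(ℝ, E) q), (∀ w, g q v w = 0) → v = 0
  J_sq : ∀ (q : M) (v : TangentSpace 𝓘(ℝ, E) q), J q (J q v) = -v
  norden : ∀ (q : M) (v w : TangentSpace 𝓘(ℝ, E) q), g q (J q v) (J q w) = -g q v w
  parallel : ∀ (q : M) (v w : TangentSpace 𝓘(ℝ, E) q), covDeriv g J q v w = 0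

/-- The manifold is of (pointwise) constant totally real sectional curvatures `ν` and `νt`:
at each point `q`, every nondegenerate totally real section has sectional curvature `ν q` and
associated sectional curvature `νt q`. -/
def KahlerNorden.HasConstantTotallyRealCurvatures
    {E : Type*} [NormedAddCommGroup E] [NormedSpace ℝ E]
    {M : Type*} [TopologicalSpace M] [ChartedSpace E M]
    (K : KahlerNorden E M) (ν νt : M → ℝ) : Prop :=
  ∀ (q : M) (x y : TangentSpace 𝓘(ℝ, E) q),
    IsNondegenerateSection (E := E) (K.g q) x y →
    IsTotallyRealSection (E := E) (K.g q) (K.J q) x y →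
      sectional (E := E) (K.g q) x y (curvature4 K.g q) = ν q ∧
      sectional (E := E) (K.g q) x y
        (fun a b c d => curvature4 K.g q a b c (K.J q d)) = νt q

/-- A real time-like hypersurface of `K`: a smooth immersion `f` of a manifold `M` modelled on
`E`, with a smooth unit normal `N` such that `g'(N, N) = -1`.  (That the codimension is one is
a condition on the dimensions of the model spaces `E` and `E'`.) -/
structure TimelikeHypersurface
    {E' : Type*} [NormedAddCommGroup E'] [NormedSpace ℝ E']
    {M' : Type*} [TopologicalSpace M'] [ChartedSpace E' M'] [IsManifold 𝓘(ℝ, E') ∞ M']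
    (K : KahlerNorden E' M')
    (E : Type*) [NormedAddCommGroup E] [NormedSpace ℝ E]
    (M : Type*) [TopologicalSpace M] [ChartedSpace E M] where
  f : M → M'
  smooth_f : ContMDiff 𝓘(ℝ, E) 𝓘(ℝ, E') ∞ f
  immersion : ∀ p : M, Function.Injective (mfderiv 𝓘(ℝ, E) 𝓘(ℝ, E') f p)
  N : ∀ p : M, TangentSpace 𝓘(ℝ, E') (f p)
  smooth_N : ContMDiff 𝓘(ℝ, E) 𝓘(ℝ, E').tangent ∞
    (fun p => (⟨f p, N p⟩ : TangentBundle 𝓘(ℝ, E') M'))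
  normal : ∀ (p : M) (x : TangentSpace 𝓘(ℝ, E) p),
    K.g (f p) (mfderiv 𝓘(ℝ, E) 𝓘(ℝ, E') f p x) (N p) = 0
  timelike : ∀ p : M, K.g (f p) (N p) (N p) = -1

namespace TimelikeHypersurface

variable {E' : Type*} [NormedAddCommGroup E'] [NormedSpace ℝ E']
  {M' : Type*} [TopologicalSpace M'] [ChartedSpace E' M'] [IsManifold 𝓘(ℝ, E') ∞ M']
  {K : KahlerNorden E' M'}
  {E : Type*} [NormedAddCommGroup E] [NormedSpace ℝ E]
  {M : Type*} [TopologicalSpace M] [ChartedSpace E M]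
  (S : TimelikeHypersurface K E M)

/-- The differential of the immersion at `p`. -/
def df (p : M) : TangentSpace 𝓘(ℝ, E) p →L[ℝ] TangentSpace 𝓘(ℝ, E') (S.f p) :=
  mfderiv 𝓘(ℝ, E) 𝓘(ℝ, E') S.f p

/-- The vector `J N`. -/
def JN (p : M) : TangentSpace 𝓘(ℝ, E') (S.f p) := K.J (S.f p) (S.N p)

/-- The induced metric, `g(x, y) = g'(df x, df y)`. -/
def g (p : M) : TangentSpace 𝓘(ℝ, E) p →L[ℝ] TangentSpace 𝓘(ℝ, E) p →L[ℝ] ℝ :=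
  ContinuousLinearMap.bilinearComp (E := E') (F := E') (E' := E) (F' := E)
    (K.g (S.f p)) (S.df p) (S.df p)

/-- The function `t = arctan g'(N, JN)`. -/
def t (p : M) : ℝ := Real.arctan (K.g (S.f p) (S.N p) (S.JN p))

/-- The `g'`-orthogonal projection of `T_{f(p)} M'` to `T_p M`: the vector `x` with
`g(x, y) = g'(w, df y)` for all `y`.  If `w = df x`, then it is `x`. -/
def tangential (p : M) : TangentSpace 𝓘(ℝ, E') (S.f p) →L[ℝ] TangentSpace 𝓘(ℝ, E) p :=
  (sharp (E := E) (S.g p)).comp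
    ((ContinuousLinearMap.precomp ℝ (S.df p)).comp (K.g (S.f p)))

/-- `ξ = sin t · N + cos t · JN`, a tangent vector of the hypersurface. -/
def ξ (p : M) : TangentSpace 𝓘(ℝ, E) p :=
  S.tangential p (Real.sin (S.t p) • S.N p + Real.cos (S.t p) • S.JN p)

/-- `η = cos t · g'(·, JN)`. -/
def η (p : M) : TangentSpace 𝓘(ℝ, E) p →L[ℝ] ℝ :=
  Real.cos (S.t p) •
    (ContinuousLinearMap.flip (E := E') (F := E') (K.g (S.f p)) (S.JN p)).comp (S.df p)

/-- `φ = J + cos t · g'(·, JN) {cos t · N - sin t · JN}`, an endomorphism of the tangent space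
of the hypersurface. -/
def φ (p : M) : TangentSpace 𝓘(ℝ, E) p →L[ℝ] TangentSpace 𝓘(ℝ, E) p :=
  (S.tangential p).comp
    ((K.J (S.f p)).comp (S.df p) +
      (S.η p).smulRight (Real.cos (S.t p) • S.N p - Real.sin (S.t p) • S.JN p))

/-- `F(x, y, z) = g((∇_x φ) y, z)`. -/
def F (p : M) (x y z : TangentSpace 𝓘(ℝ, E) p) : ℝ :=
  S.g p (covDeriv S.g S.φ p x y) z

/-- `θ(z) = g^{ij} F(e_i, e_j, z)`, with `{e_i, ξ}` a basis of the tangent space, `e_i ⟂ ξ`. -/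
def θ [FiniteDimensional ℝ E] (p : M) (z : TangentSpace 𝓘(ℝ, E) p) : ℝ :=
  contractPerp (E := E) (S.g p) (S.ξ p) fun x y => S.F p x y z

/-- `θ*(z) = g^{ij} F(e_i, φ e_j, z)`, with `{e_i, ξ}` a basis of the tangent space,
`e_i ⟂ ξ`. -/
def θs [FiniteDimensional ℝ E] (p : M) (z : TangentSpace 𝓘(ℝ, E) p) : ℝ :=
  contractPerp (E := E) (S.g p) (S.ξ p) fun x y => S.F p x (S.φ p y) z

/-- `dt(ξ)`. -/
def dtξ (p : M) : ℝ := mfderiv 𝓘(ℝ, E) 𝓘(ℝ, ℝ) S.t p (S.ξ p)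

/-- The class `F₄ ⊕ F₅` of hypersurfaces of dimension `2n + 1`. -/
def IsF4F5 [FiniteDimensional ℝ E] (n : ℕ) : Prop :=
  ∀ (p : M) (x y z : TangentSpace 𝓘(ℝ, E) p),
    S.F p x y z =
      -(S.θ p (S.ξ p) / (2 * n)) *
        (S.g p (S.φ p x) (S.φ p y) * S.η p z + S.g p (S.φ p x) (S.φ p z) * S.η p y)
      - S.θs p (S.ξ p) / (2 * n) *
        (S.g p x (S.φ p y) * S.η p z + S.g p x (S.φ p z) * S.η p y)

/-- The curvature tensor `R(x, y, z, u)` of the Levi-Civita connection of the induced metric. -/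
def R (p : M) (x y z u : TangentSpace 𝓘(ℝ, E) p) : ℝ := curvature4 S.g p x y z u

/-- The scalar curvature `τ`. -/
def τ [FiniteDimensional ℝ E] (p : M) : ℝ := scalar (E := E) (S.g p) (S.R p)

/-- The associated scalar curvature, that of `R(x, y, z, φ u)`. -/
def τt [FiniteDimensional ℝ E] (p : M) : ℝ :=
  scalar (E := E) (S.g p) fun x y z u => S.R p x y z (S.φ p u)

/-- The sectional curvature `k(x, y)`. -/
def k (p : M) (x y : TangentSpace 𝓘(ℝ, E) p) : ℝ := sectional (E := E) (S.g p) x y (S.R p)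

end TimelikeHypersurface

end Norden

end

/-!
Everything happens at one point `p`, once the geometry has been reduced to three facts about the
tangent space.

*The ambient curvature.* Let `g` be a Norden metric with complex structure `J`, and `T` a
curvature tensor with `T(x, y, J z, u) = T(x, y, z, J u)`. Then `g(x, y) - i g(x, J y)` is a
complex bilinear form, and `T(x, y, y, x) - i T(x, y, y, J x)` is a complex quadratic form in `x`
and in `y`, whose vanishing only depends on the complex plane spanned by `x` and `y`. A
nondegenerate complex plane has an orthonormal basis, since one can take square roots in `ℂ`, and
the real span of this basis is totally real. So vanishing on totally real sections implies vanishing on nondegenerate complex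
planes, hence everywhere, by a polynomial argument on lines (`IsKahlerTensor.eq_zero`). Applied to
the difference of the two sides this gives `R' = ν (π₁ - π₂) + νt π₃`
(`KahlerNorden.curvature4_eq`).

*The shape operator.* Let `∇' N = -A`. Since `∇' J = 0`, the Gauss and Weingarten formulas express
`F` by `A` (`TimelikeHypersurface.F_eq`):
`F(x, y, z) = g(-cos t A x + sin t φ A x, y) η(z) + (y ↔ z) + 2 cos t η(A x) η(y) η(z)`,
and give `dt(x) = -2 cos t η(A x)` (`TimelikeHypersurface.dtξ_eq`). On an `F₄ ⊕ F₅` manifold the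
first formula can be solved for `A`, because `-cos t + sin t φ` is invertible on `ker η`:
`A x = η(A ξ) η(x) ξ + P φ² x - Q φ x` with `2n P = θ(ξ) cos t + θ*(ξ) sin t` and
`2n Q = θ(ξ) sin t - θ*(ξ) cos t` (`IsAlmostContact.shape_operator`).

*The Gauss equation.* `R` is the restriction of `R'` minus
`g(A y, z) g(A x, u) - g(A x, z) g(A y, u)`, the normal being time-like, and
`g'(x, J y) = g(x, φ y) + tan t η(x) η(y)` on tangent vectors. So `R` is a combination of
`π₁, …, π₅` (`IsAlmostContact.gauss_formula`, `TimelikeHypersurface.R_eq`). Its scalar curvatures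
are traces of products of `φ` and `η ⊗ ξ`, where `φ` is traceless because `φ³ = -φ`; on a
`φ`-invariant section `φ` has trace `0` and determinant `1`, so that `π₁` and `π₂` agree there and
the other tensors vanish.

The connection and the curvature at `p` are computed in the chart at `p`. The coordinate parts
therefore work with germs of metrics on vector spaces (`IsMetricNear`, `IsHypersurfaceNear`). The
condition `∇' J = 0`, stated at the centre of each chart, has to be carried to the other points of
the chart by the transition maps (`KahlerNorden.coordCovDeriv_eq_zero`).
-/

noncomputable section

namespace Norden

/-! ### Curvature-like tensors -/

section CurvatureLike

variable {V : Type*} [AddCommGroup V] [Module ℝ V]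

/-- A quadrilinear form with the symmetries of a Riemannian curvature tensor of type `(0,4)`.
Linearity in the first slot gives linearity in the others by the symmetries. -/
structure IsCurvatureLike (T : V → V → V → V → ℝ) : Prop where
  add : ∀ x x' y z u, T (x + x') y z u = T x y z u + T x' y z u
  smul : ∀ (c : ℝ) x y z u, T (c • x) y z u = c * T x y z u
  skew : ∀ x y z u, T x y z u = -T y x z u
  skew' : ∀ x y z u, T x y z u = -T x y u z
  bianchi : ∀ x y z u, T x y z u + T y z x u + T z x y u = 0

namespace IsCurvatureLike

variable {T : V → V → V → V → ℝ} (hT : IsCurvatureLike T)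

include hT

theorem pair_symm (x y z u : V) : T x y z u = T z u x y := by
  have h1 := hT.bianchi x y z u
  have h2 := hT.bianchi y z u x
  have h3 := hT.bianchi z u x y
  have h4 := hT.bianchi u x y z
  linarith [hT.skew' x y z u, hT.skew' y z x u, hT.skew' z x y u, hT.skew' y z u x,
    hT.skew' z u y x, hT.skew' u y z x, hT.skew z x y u, hT.skew x z y u, hT.skew u y z x,
    hT.skew' z u x y, hT.skew' u x z y, hT.skew' x z u y, hT.skew' u x y z, hT.skew' x y u z,
    hT.skew' y u x z, hT.skew y u x z, hT.skew' y u z x]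

theorem add₂ (x y y' z u : V) : T x (y + y') z u = T x y z u + T x y' z u := by
  rw [hT.skew, hT.add, hT.skew x y, hT.skew x y']; ring

theorem add₃ (x y z z' u : V) : T x y (z + z') u = T x y z u + T x y z' u := by
  rw [hT.pair_symm, hT.add, hT.pair_symm x y, hT.pair_symm x y]

theorem add₄ (x y z u u' : V) : T x y z (u + u') = T x y z u + T x y z u' := by
  rw [hT.pair_symm, hT.add₂, hT.pair_symm x y, hT.pair_symm x y]

theorem smul₂ (c : ℝ) (x y z u : V) : T x (c • y) z u = c * T x y z u := by
  rw [hT.skew, hT.smul, hT.skew x y]; ring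

theorem smul₃ (c : ℝ) (x y z u : V) : T x y (c • z) u = c * T x y z u := by
  rw [hT.pair_symm, hT.smul, hT.pair_symm x y]

theorem smul₄ (c : ℝ) (x y z u : V) : T x y z (c • u) = c * T x y z u := by
  rw [hT.pair_symm, hT.smul₂, hT.pair_symm x y]

/-- A curvature tensor is determined by the values `T(x, y, y, x)`. -/
theorem eq_zero_of_sectional (h : ∀ x y, T x y y x = 0) (x y z u : V) : T x y z u = 0 := by
  have h3 : ∀ x y z, T x y y z = 0 := by
    intro x y z
    have h1 := h (x + z) y
    simp only [hT.add, hT.add₄, h] at h1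
    have h2 : T z y y x = T x y y z := by
      rw [hT.pair_symm, hT.skew, hT.skew']; ring
    linarith
  have h4 : ∀ x y z w, T x y z w = -T x z y w := by
    intro x y z w
    have h1 := h3 x (y + z) w
    simp only [hT.add₂, hT.add₃, h3] at h1
    linarith
  have h5 := hT.bianchi x y z u
  linarith [h4 y z x u, hT.skew y x z u, hT.skew z x y u, h4 x z y u]

end IsCurvatureLike

end CurvatureLike

/-! ### Kähler-Norden curvature tensors of constant totally real sectional curvatures -/

section Complex

variable {V : Type*} [AddCommGroup V] [Module ℝ V]

/-- The action of a complex number on a real vector space with an endomorphism `J`; it is scalar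
multiplication when `J² = -1`. -/
def cmul (J : V →ₗ[ℝ] V) (c : ℂ) (x : V) : V := c.re • x + c.im • J x

/-- A Norden metric on a real vector space: a nondegenerate symmetric bilinear form `G` and a
complex structure `J` that is an anti-isometry of `G`. -/
structure IsNorden (G : V →ₗ[ℝ] V →ₗ[ℝ] ℝ) (J : V →ₗ[ℝ] V) : Prop where
  symm : ∀ x y, G x y = G y x
  nondeg : ∀ x, (∀ y, G x y = 0) → x = 0
  sq : ∀ x, J (J x) = -x
  anti : ∀ x y, G (J x) (J y) = -G x y

namespace IsNorden

variable {G : V →ₗ[ℝ] V →ₗ[ℝ] ℝ} {J : V →ₗ[ℝ] V}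

theorem self_adjoint (h : IsNorden G J) (x y : V) : G (J x) y = G x (J y) := by
  have := h.anti x (J y)
  rw [h.sq, map_neg] at this
  linarith

end IsNorden

/-- The complex bilinear form `G(x, y) - i G(x, J y)` with real part the Norden metric `G`. -/
def complexForm (G : V →ₗ[ℝ] V →ₗ[ℝ] ℝ) (J : V →ₗ[ℝ] V) (x y : V) : ℂ :=
  ⟨G x y, -G x (J y)⟩

/-- The complex number `T(x, y, y, x) - i T(x, y, y, J x)`. For a curvature tensor `T` compatible
with `J` it is a complex quadratic form in `x` and in `y`. -/
def complexSectional (T : V → V → V → V → ℝ) (J : V →ₗ[ℝ] V) (x y : V) : ℂ :=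
  ⟨T x y y x, -T x y y (J x)⟩

/-- The Gram determinant of `x, y` for the complex form. -/
def complexGram (G : V →ₗ[ℝ] V →ₗ[ℝ] ℝ) (J : V →ₗ[ℝ] V) (x y : V) : ℂ :=
  complexForm G J x x * complexForm G J y y - complexForm G J x y ^ 2

variable {G : V →ₗ[ℝ] V →ₗ[ℝ] ℝ} {J : V →ₗ[ℝ] V}

theorem complexForm_comm (h : IsNorden G J) (x y : V) :
    complexForm G J x y = complexForm G J y x := by
  simp only [complexForm, h.symm x y]
  rw [← h.self_adjoint x y, h.symm (J x) y]

theorem complexForm_add (x y z : V) :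
    complexForm G J x (y + z) = complexForm G J x y + complexForm G J x z := by
  apply Complex.ext
  · simp [complexForm]
  · simp [complexForm]; ring

theorem complexForm_cmul (h : IsNorden G J) (c : ℂ) (x y : V) :
    complexForm G J x (cmul J c y) = c * complexForm G J x y := by
  apply Complex.ext
  · simp [complexForm, cmul, h.sq]
  · simp [complexForm, cmul, h.sq]; ring

theorem complexForm_add_left (h : IsNorden G J) (x y z : V) :
    complexForm G J (x + y) z = complexForm G J x z + complexForm G J y z := by
  rw [complexForm_comm h, complexForm_add, complexForm_comm h z, complexForm_comm h z]

theorem complexForm_cmul_left (h : IsNorden G J) (c : ℂ) (x y : V) :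
    complexForm G J (cmul J c x) y = c * complexForm G J x y := by
  rw [complexForm_comm h, complexForm_cmul h, complexForm_comm h y]

/-- A curvature-like tensor of Kähler type: `T(x, y, J z, u) = T(x, y, z, J u)`. -/
structure IsKahlerTensor (J : V →ₗ[ℝ] V) (T : V → V → V → V → ℝ) : Prop
    extends IsCurvatureLike T where
  kahler : ∀ x y z u, T x y (J z) u = T x y z (J u)

namespace IsKahlerTensor

variable {T : V → V → V → V → ℝ}

theorem kahler₁ (hT : IsKahlerTensor J T) (x y z u : V) : T (J x) y z u = T x (J y) z u := by
  rw [hT.pair_symm, hT.kahler, hT.pair_symm]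

/-- `J` can be moved from the second pair of slots to the first one, by the Bianchi identity. -/
theorem kahler₁₄ (hT : IsKahlerTensor J T) (x y z u : V) : T (J x) y z u = T x y z (J u) := by
  have e1 := hT.bianchi x y z (J u)
  have e2 := hT.bianchi (J x) y z u
  have e3 := hT.bianchi x (J y) z u
  have e4 := hT.bianchi x y (J z) u
  have k1 := hT.kahler x y z u
  have k2 := hT.kahler y z x u
  have k3 := hT.kahler z x y u
  have l1 := hT.kahler₁ x y z u
  have l2 := hT.kahler₁ y z x u
  have l3 := hT.kahler₁ z x y u
  linarith

theorem complexSectional_comm (hT : IsKahlerTensor J T) (x y : V) :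
    complexSectional T J x y = complexSectional T J y x := by
  have e1 : T x y y x = T y x x y := by rw [hT.skew, hT.skew']; ring
  have e2 : T x y y (J x) = T y x x (J y) := by
    rw [hT.skew, hT.skew', hT.kahler]; ring
  simp only [complexSectional, e1, e2]

theorem complexSectional_cmul (hT : IsKahlerTensor J T) (hJ : ∀ x, J (J x) = -x) (c : ℂ)
    (x y : V) : complexSectional T J (cmul J c x) y = c ^ 2 * complexSectional T J x y := by
  have hneg : ∀ a b d e : V, T a b d (-e) = -T a b d e := by
    intro a b d e; rw [← neg_one_smul ℝ e, hT.smul₄]; ring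
  apply Complex.ext <;>
    simp only [complexSectional, cmul, map_add, map_smul, map_neg, hJ, hT.add, hT.add₄, hT.smul,
      hT.smul₄, hT.kahler₁₄, Complex.mul_re, Complex.mul_im, pow_two, hneg] <;> ring

theorem complexSectional_add_cmul (hT : IsKahlerTensor J T) (hJ : ∀ x, J (J x) = -x) (c : ℂ)
    (x y : V) : complexSectional T J (x + cmul J c y) y = complexSectional T J x y := by
  have hneg : ∀ a b d e : V, T a b d (-e) = -T a b d e := by
    intro a b d e; rw [← neg_one_smul ℝ e, hT.smul₄]; ring
  have h1 : ∀ a b d, T a a b d = 0 := by intro a b d; linarith [hT.skew a a b d]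
  have h2 : ∀ a b d, T a b d d = 0 := by intro a b d; linarith [hT.skew' a b d d]
  have h3 : ∀ a b d, T a b d (J d) = 0 := by
    intro a b d; linarith [hT.skew' a b d (J d), hT.kahler a b d d]
  apply Complex.ext <;>
    simp only [complexSectional, cmul, map_add, map_smul, map_neg, hJ, hT.add, hT.add₄, hT.smul,
      hT.smul₄, hT.kahler₁₄, h1, h2, h3, hneg] <;> ring

/-- Along a real line `y + ε v` the complex sectional form is a quadratic polynomial in `ε`. -/
theorem exists_complexSectional_line (hT : IsKahlerTensor J T) (x y v : V) :
    ∃ b : ℂ, ∀ ε : ℝ, complexSectional T J x (y + ε • v) =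
      complexSectional T J x y + b * ε + complexSectional T J x v * ε ^ 2 := by
  refine ⟨⟨T x y v x + T x v y x, -(T x y v (J x) + T x v y (J x))⟩, fun ε => ?_⟩
  apply Complex.ext <;>
    simp [complexSectional, hT.add₂, hT.add₃, hT.smul₂, hT.smul₃, pow_two] <;> ring

end IsKahlerTensor

theorem exists_complexGram_line (h : IsNorden G J) (x y v : V) :
    ∃ b : ℂ, ∀ ε : ℝ, complexGram G J x (y + ε • v) =
      complexGram G J x y + b * ε + complexGram G J x v * ε ^ 2 := by
  refine ⟨2 * (complexForm G J x x * complexForm G J y v -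
    complexForm G J x y * complexForm G J x v), fun ε => ?_⟩
  have e : ε • v = cmul J ε v := by simp [cmul]
  simp only [complexGram, e, complexForm_add, complexForm_add_left h, complexForm_cmul h,
    complexForm_cmul_left h, complexForm_comm h v y]
  ring

/-- If the product of two complex quadratic polynomials vanishes at all real numbers and the
second has nonzero leading coefficient, then the first is zero. -/
theorem quadratic_eq_zero {a b c d e f : ℂ} (hf : f ≠ 0)
    (h : ∀ ε : ℝ, (a + b * ε + c * ε ^ 2) * (d + e * ε + f * ε ^ 2) = 0) : a = 0 := by
  open Polynomial in
  have hp : ((C a + C b * X + C c * X ^ 2) * (C d + C e * X + C f * X ^ 2) : ℂ[X]) = 0 := by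
    refine Polynomial.eq_zero_of_infinite_isRoot _ ?_
    refine (Set.infinite_range_of_injective Complex.ofReal_injective).mono ?_
    rintro _ ⟨ε, rfl⟩
    simpa [Polynomial.IsRoot] using h ε
  rcases mul_eq_zero.1 hp with h1 | h1
  · simpa using congrArg (fun p => p.coeff 0) h1
  · exfalso
    apply hf
    simpa [Polynomial.coeff_X, Polynomial.coeff_C] using congrArg (fun p => p.coeff 2) h1

/-- A Kähler tensor with vanishing totally real sectional curvatures is zero. Every nondegenerate
complex plane has an orthonormal basis for the complex form, and such a basis spans a totally real
section; the other planes are limits of these. -/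
theorem IsKahlerTensor.eq_zero [FiniteDimensional ℝ V] (h : IsNorden G J)
    (hdim : 2 < Module.finrank ℝ V) {T : V → V → V → V → ℝ} (hT : IsKahlerTensor J T)
    (h0 : ∀ x y, G x x = 1 → G y y = 1 → G x y = 0 → G x (J x) = 0 → G x (J y) = 0 →
      G y (J y) = 0 → T x y y x = 0 ∧ T x y y (J x) = 0) (x y z u : V) : T x y z u = 0 := by
  set Q := complexSectional T J with hQ
  set B := complexForm G J with hB
  set D := complexGram G J with hD
  have hDdef : ∀ x y, D x y = B x x * B y y - B x y ^ 2 := fun _ _ => rfl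
  have hJ := h.sq
  have Qadd : ∀ c x y, Q (x + cmul J c y) y = Q x y := fun c x y =>
    hT.complexSectional_add_cmul hJ c x y
  have Qmul : ∀ c x y, Q (cmul J c x) y = c ^ 2 * Q x y := fun c x y =>
    hT.complexSectional_cmul hJ c x y
  have Qcomm : ∀ x y, Q x y = Q y x := fun x y => hT.complexSectional_comm x y
  have Badd : ∀ x y z, B (x + y) z = B x z + B y z := complexForm_add_left h
  have Badd' : ∀ x y z, B x (y + z) = B x y + B x z := complexForm_add
  have Bmul : ∀ c x y, B (cmul J c x) y = c * B x y := complexForm_cmul_left h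
  have Bmul' : ∀ c x y, B x (cmul J c y) = c * B x y := complexForm_cmul h
  have Bcomm : ∀ x y, B x y = B y x := complexForm_comm h
  -- orthonormal bases
  have s1 : ∀ x y, B x x = 1 → B y y = 1 → B x y = 0 → Q x y = 0 := by
    intro x y hx hy hxy
    have hx1 := congrArg Complex.re hx
    have hx2 := congrArg Complex.im hx
    have hy1 := congrArg Complex.re hy
    have hy2 := congrArg Complex.im hy
    have hz1 := congrArg Complex.re hxy
    have hz2 := congrArg Complex.im hxy
    simp only [hB, complexForm, Complex.one_re, Complex.one_im, Complex.zero_re, Complex.zero_im,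
      neg_eq_zero] at hx1 hx2 hy1 hy2 hz1 hz2
    obtain ⟨h1, h2⟩ := h0 x y hx1 hy1 hz1 hx2 hz2 hy2
    apply Complex.ext <;> simp [hQ, complexSectional, h1, h2]
  have hsqrt : ∀ w : ℂ, w ≠ 0 → ∃ s : ℂ, s ≠ 0 ∧ s ^ 2 * w = 1 := by
    intro w hw
    obtain ⟨s, hs⟩ := IsAlgClosed.exists_pow_nat_eq w⁻¹ (n := 2) (by norm_num)
    refine ⟨s, ?_, by rw [hs, inv_mul_cancel₀ hw]⟩
    rintro rfl
    rw [zero_pow two_ne_zero] at hs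
    exact inv_ne_zero hw hs.symm
  -- orthogonal bases without isotropic vectors
  have s2 : ∀ x y, B x x ≠ 0 → B y y ≠ 0 → B x y = 0 → Q x y = 0 := by
    intro x y hx hy hxy
    obtain ⟨s, hs, hs'⟩ := hsqrt _ hx
    obtain ⟨r, hr, hr'⟩ := hsqrt _ hy
    have := s1 (cmul J s x) (cmul J r y) (by rw [Bmul, Bmul', ← hs']; ring)
      (by rw [Bmul, Bmul', ← hr']; ring) (by rw [Bmul, Bmul', hxy]; ring)
    rw [Qmul, Qcomm, Qmul, Qcomm y x] at this
    simpa [hs, hr] using this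
  -- nondegenerate planes, by the Gram-Schmidt process
  have s3 : ∀ x y, B x x ≠ 0 → D x y ≠ 0 → Q x y = 0 := by
    intro x y hx hxy
    have := s2 x (y + cmul J (-(B x y / B x x)) x) hx ?_ ?_
    · rwa [Qcomm, Qadd, Qcomm] at this
    · intro h1
      apply hxy
      have e : B x x * B (y + cmul J (-(B x y / B x x)) x)
          (y + cmul J (-(B x y / B x x)) x) = D x y := by
        simp only [Badd, Badd', Bmul, Bmul', hDdef, Bcomm y x]; field_simp; ring
      rw [← e, h1, mul_zero]
    · rw [Badd', Bmul']; field_simp; ring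
  -- any second vector
  have s4 : ∀ x y, B x x ≠ 0 → Q x y = 0 := by
    intro x y hx
    have hv : ∃ v, D x v ≠ 0 := by
      by_contra! hall
      obtain ⟨v, hv, hv0⟩ : ∃ v ∈ LinearMap.ker ((G x).prod (G (J x))), v ≠ 0 := by
        apply Submodule.exists_mem_ne_zero_of_ne_bot
        apply LinearMap.ker_ne_bot_of_finrank_lt
        simpa using hdim
      have hv' : G x v = 0 ∧ G (J x) v = 0 := by simpa using hv
      have hxv : B x v = 0 := by
        apply Complex.ext <;> simp [hB, complexForm, hv'.1, ← h.self_adjoint, hv'.2]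
      apply hv0
      apply h.nondeg
      intro w
      have e1 := hall (v + w)
      have e2 := hall v
      have e3 := hall w
      simp only [hDdef, Badd, Badd', hxv, Bcomm w v] at e1 e2 e3
      have : B x x * B v w = 0 := by linear_combination (e1 - e2 - e3) / 2
      have := (mul_eq_zero.1 this).resolve_left hx
      simpa [hB, complexForm] using congrArg Complex.re this
    obtain ⟨v, hv⟩ := hv
    obtain ⟨b, hb⟩ := hT.exists_complexSectional_line x y v
    obtain ⟨e, he⟩ := exists_complexGram_line h x y v
    refine quadratic_eq_zero hv (b := b) (c := Q x v) (d := D x y) (e := e) fun ε => ?_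
    rw [← hb, ← he]
    by_cases h1 : D x (y + ε • v) = 0
    · rw [← hD, h1, mul_zero]
    · rw [← hQ, s3 x _ hx h1, zero_mul]
  have s5 : ∀ x y, Q x y = 0 := by
    intro x y
    have hu : ∃ u, B u u ≠ 0 := by
      by_contra! hall
      have : Nontrivial V := Module.nontrivial_of_finrank_pos (R := ℝ) (by omega)
      obtain ⟨v, hv0⟩ := exists_ne (0 : V)
      apply hv0
      apply h.nondeg
      intro w
      have e1 := hall (v + w)
      simp only [Badd, Badd', hall, Bcomm w v] at e1
      have : B v w = 0 := by linear_combination e1 / 2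
      simpa [hB, complexForm] using congrArg Complex.re this
    obtain ⟨u, hu⟩ := hu
    obtain ⟨b, hb⟩ := hT.exists_complexSectional_line y x u
    rw [Qcomm]
    refine quadratic_eq_zero hu (b := b) (c := Q y u) (d := B x x) (e := 2 * B x u) fun ε => ?_
    have he : B x x + 2 * B x u * ε + B u u * ε ^ 2 = B (x + ε • u) (x + ε • u) := by
      have e : ε • u = cmul J ε u := by simp [cmul]
      simp only [e, Badd, Badd', Bmul, Bmul', Bcomm u x]; ring
    rw [he, ← hb, ← hQ, Qcomm]
    by_cases h1 : B (x + ε • u) (x + ε • u) = 0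
    · rw [h1, mul_zero]
    · rw [s4 _ _ h1, zero_mul]
  refine hT.eq_zero_of_sectional (fun x y => ?_) x y z u
  simpa [hQ, complexSectional] using congrArg Complex.re (s5 x y)

end Complex

/-! ### Metric contractions -/

section Contraction

variable {E : Type*} [NormedAddCommGroup E] [NormedSpace ℝ E] [FiniteDimensional ℝ E]

theorem isInvertible_of_nondegenerate {G : E →L[ℝ] E →L[ℝ] ℝ}
    (hG : ∀ v, (∀ w, G v w = 0) → v = 0) : G.IsInvertible := by
  have hinj : Function.Injective G.toLinearMap := by
    rw [← LinearMap.ker_eq_bot, LinearMap.ker_eq_bot']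
    intro v hv
    exact hG v fun w => by simpa using congrArg (fun l : E →L[ℝ] ℝ => l w) hv
  have hdim : Module.finrank ℝ E = Module.finrank ℝ (E →L[ℝ] ℝ) := by
    rw [← (LinearMap.toContinuousLinearMap : (E →ₗ[ℝ] ℝ) ≃ₗ[ℝ] (E →L[ℝ] ℝ)).finrank_eq]
    exact Subspace.dual_finrank_eq.symm
  exact ⟨(LinearEquiv.ofInjectiveOfFinrankEq G.toLinearMap hinj hdim).toContinuousLinearEquiv,
    by ext; rfl⟩

omit [FiniteDimensional ℝ E] in
theorem apply_sharp {G : E →L[ℝ] E →L[ℝ] ℝ} (hG : G.IsInvertible) (l : E →L[ℝ] ℝ) :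
    G (sharp G l) = l :=
  hG.self_apply_inverse l

theorem contract_add (G : E →L[ℝ] E →L[ℝ] ℝ) (B C : E → E → ℝ) :
    contract G (fun x y => B x y + C x y) = contract G B + contract G C := by
  simp only [contract, mul_add, Finset.sum_add_distrib]

theorem contract_const_mul (G : E →L[ℝ] E →L[ℝ] ℝ) (c : ℝ) (B : E → E → ℝ) :
    contract G (fun x y => c * B x y) = c * contract G B := by
  simp only [contract, Finset.mul_sum]
  exact Finset.sum_congr rfl fun _ _ => Finset.sum_congr rfl fun _ _ => by ring

theorem scalar_add (G : E →L[ℝ] E →L[ℝ] ℝ) (R S : E → E → E → E → ℝ) :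
    scalar G (fun x y z u => R x y z u + S x y z u) = scalar G R + scalar G S := by
  simp only [scalar, contract_add]

theorem scalar_const_mul (G : E →L[ℝ] E →L[ℝ] ℝ) (c : ℝ) (R : E → E → E → E → ℝ) :
    scalar G (fun x y z u => c * R x y z u) = c * scalar G R := by
  simp only [scalar, contract_const_mul]

/-- The Gram matrix used by `contract`. -/
def gram (G : E →L[ℝ] E →L[ℝ] ℝ) :
    Matrix (Fin (Module.finrank ℝ E)) (Fin (Module.finrank ℝ E)) ℝ :=
  Matrix.of fun k l => G (Module.finBasis ℝ E k) (Module.finBasis ℝ E l)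

variable {G : E →L[ℝ] E →L[ℝ] ℝ} (hsymm : ∀ v w, G v w = G w v)
  (hG : ∀ v, (∀ w, G v w = 0) → v = 0)

include hG in
theorem isUnit_det_gram : IsUnit (gram G).det := by
  rw [isUnit_iff_ne_zero]
  intro h0
  obtain ⟨v, hv, hv0⟩ := Matrix.exists_vecMul_eq_zero_iff.2 h0
  apply hv
  have hsum : ∑ i, v i • Module.finBasis ℝ E i = 0 := by
    apply hG
    intro w
    rw [← (Module.finBasis ℝ E).sum_repr w]
    simp only [map_sum, map_smul, smul_eq_mul]
    refine Finset.sum_eq_zero fun j _ => ?_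
    have := congrFun hv0 j
    simp only [Matrix.vecMul, dotProduct, gram, Matrix.of_apply, Pi.zero_apply] at this
    simp [this]
  funext i
  exact Fintype.linearIndependent_iff.1 (Module.finBasis ℝ E).linearIndependent v hsum i

include hsymm in
theorem gram_inv_symm (i j) : (gram G)⁻¹ i j = (gram G)⁻¹ j i := by
  have h : (gram G).transpose = gram G := by ext k l; simp [gram, hsymm]
  have := congrFun (congrFun (Matrix.transpose_nonsing_inv (gram G)) j) i
  rw [h] at this
  simpa using this

include hsymm hG

/-- Contracting `G(L x, y)` gives the trace of `L`. -/
theorem contract_endo (L : E →ₗ[ℝ] E) :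
    contract G (fun x y => G (L x) y) = LinearMap.trace ℝ E L := by
  set e := Module.finBasis ℝ E
  have hL : ∀ i, L (e i) = ∑ k, LinearMap.toMatrix e e L k i • e k := fun i => by
    simp only [LinearMap.toMatrix_apply]
    exact (e.sum_repr (L (e i))).symm
  rw [LinearMap.trace_eq_matrix_trace ℝ e, Matrix.trace]
  change ∑ i, ∑ j, (gram G)⁻¹ i j * G (L (e i)) (e j) = _
  refine Finset.sum_congr rfl fun i _ => ?_
  have h1 : ∀ j, (gram G)⁻¹ i j * G (L (e i)) (e j) =
      ∑ k, LinearMap.toMatrix e e L k i * (gram G k j * (gram G)⁻¹ j i) := by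
    intro j
    rw [hL i]
    simp only [map_sum, map_smul, sum_apply, smul_apply,
      smul_eq_mul, Finset.mul_sum]
    refine Finset.sum_congr rfl fun k _ => ?_
    rw [gram_inv_symm hsymm i j]
    simp only [gram, Matrix.of_apply]
    ring
  simp only [h1]
  rw [Finset.sum_comm]
  simp only [← Finset.mul_sum, ← Matrix.mul_apply, Matrix.mul_nonsing_inv _ (isUnit_det_gram hG),
    Matrix.diag_apply, Matrix.one_apply]
  simp

theorem contract_rank_one (v w : E) :
    contract G (fun x y => G x v * G w y) = G w v := by
  have h1 : (fun x y => G x v * G w y) = fun x y => G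
      ((G.toLinearMap v).toLinearMap.smulRight w x) y := by
    funext x y
    simp [hsymm x v]
  rw [h1, contract_endo hsymm hG]
  simp [hsymm v w]

/-- The scalar curvature of the elementary tensor built from two endomorphisms `P, Q`. -/
theorem scalar_endo (P Q : E →ₗ[ℝ] E) (hP : ∀ x y, G (P x) y = G x (P y)) :
    scalar G (fun x y z u => G (P y) z * G (Q x) u - G (P x) z * G (Q y) u) =
      LinearMap.trace ℝ E P * LinearMap.trace ℝ E Q - LinearMap.trace ℝ E (P ∘ₗ Q) := by
  have h1 : ∀ y z, contract G (fun x u => G (P y) z * G (Q x) u - G (P x) z * G (Q y) u) =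
      LinearMap.trace ℝ E Q * G (P y) z + (-1) * G ((P ∘ₗ Q) y) z := by
    intro y z
    have h2 : (fun x u => G (P y) z * G (Q x) u - G (P x) z * G (Q y) u) =
        fun x u => G (P y) z * G (Q x) u + (-1) * (G x (P z) * G (Q y) u) := by
      funext x u; rw [hP x z]; ring
    rw [h2, contract_add, contract_const_mul, contract_const_mul, contract_endo hsymm hG,
      contract_rank_one hsymm hG, LinearMap.comp_apply, hP (Q y) z]
    ring
  simp only [scalar, h1]
  rw [contract_add, contract_const_mul, contract_const_mul, contract_endo hsymm hG,
    contract_endo hsymm hG]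
  ring

end Contraction

/-- An endomorphism with `φ³ = -φ` is traceless: its complex eigenvalues are purely imaginary. -/
theorem trace_eq_zero_of_cube {V : Type*} [AddCommGroup V] [Module ℝ V] [FiniteDimensional ℝ V]
    (φ : V →ₗ[ℝ] V) (h : ∀ x, φ (φ (φ x)) = -φ x) : LinearMap.trace ℝ V φ = 0 := by
  set b := Module.finBasis ℝ V
  set A := LinearMap.toMatrix b b φ with hA
  have hcube : A * A * A = -A := by
    rw [hA, ← LinearMap.toMatrix_comp, ← LinearMap.toMatrix_comp, ← map_neg]
    congr 1
    ext x
    simp [h]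
  set C := A.map (algebraMap ℝ ℂ) with hC
  have hC3 : C * C * C = -C := by
    rw [hC, ← Matrix.map_mul, ← Matrix.map_mul, hcube]
    ext; simp
  have htr : ((LinearMap.trace ℝ V φ : ℝ) : ℂ) = C.charpoly.roots.sum := by
    rw [← Matrix.trace_eq_sum_roots_charpoly, LinearMap.trace_eq_matrix_trace ℝ b]
    simp [hC, ← hA, Matrix.trace]
  have hre : ∀ z ∈ C.charpoly.roots, z.re = 0 := by
    intro z hz
    have hz' : Module.End.HasEigenvalue (Matrix.toLin' C) z := by
      rw [Module.End.hasEigenvalue_iff_isRoot_charpoly, Matrix.charpoly_toLin']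
      exact Polynomial.isRoot_of_mem_roots hz
    obtain ⟨v, hv⟩ := hz'.exists_hasEigenvector
    have hv1 : C.mulVec v = z • v := by simpa using hv.apply_eq_smul
    have hv3 : z ^ 3 • v = (-z) • v := by
      have := congrArg (fun D => Matrix.mulVec D v) hC3
      simp only [← Matrix.mulVec_mulVec, Matrix.neg_mulVec, hv1, Matrix.mulVec_smul] at this
      rw [neg_smul, ← this, smul_smul, smul_smul]
      congr 1; ring
    have hz3 : z * (z ^ 2 + 1) = 0 := by
      have h1 := sub_eq_zero.2 hv3
      rw [← sub_smul] at h1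
      rcases smul_eq_zero.1 h1 with h2 | h2
      · linear_combination h2
      · exact absurd h2 hv.2
    rcases mul_eq_zero.1 hz3 with h1 | h1
    · simp [h1]
    · have h2 : (z - Complex.I) * (z + Complex.I) = 0 := by
        linear_combination h1 - Complex.I_sq
      rcases mul_eq_zero.1 h2 with h3 | h3
      · simp [sub_eq_zero.1 h3]
      · simp [eq_neg_of_add_eq_zero_left h3]
  have h0 : (C.charpoly.roots.sum).re = 0 := by
    rw [← Complex.coe_reAddGroupHom, map_multiset_sum]
    apply Multiset.sum_eq_zero
    intro x hx
    obtain ⟨z, hz, rfl⟩ := Multiset.mem_map.1 hx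
    exact hre z hz
  rw [← htr] at h0
  simpa using h0

/-! ### Almost contact Norden structures in one tangent space -/

section AlmostContact

variable {E : Type*} [NormedAddCommGroup E] [NormedSpace ℝ E]

/-- An almost contact structure `(φ, ξ, η)` on a vector space with a compatible Norden metric
(B-metric) `g`; the compatibility is expressed as self-adjointness of `φ`. -/
structure IsAlmostContact (g : E →L[ℝ] E →L[ℝ] ℝ) (φ : E →L[ℝ] E) (η : E →L[ℝ] ℝ) (ξ : E) :
    Prop where
  symm : ∀ x y, g x y = g y x
  nondeg : ∀ x, (∀ y, g x y = 0) → x = 0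
  self_adjoint : ∀ x y, g (φ x) y = g x (φ y)
  sq : ∀ x, φ (φ x) = -x + η x • ξ
  eta : ∀ x, η x = g x ξ
  unit : η ξ = 1

/-- The combination `a₁ π₁ + … + a₅ π₅`. -/
def piSum (g : E →L[ℝ] E →L[ℝ] ℝ) (φ : E →L[ℝ] E) (η : E →L[ℝ] ℝ) (a₁ a₂ a₃ a₄ a₅ : ℝ)
    (x y z u : E) : ℝ :=
  a₁ * pi1 g x y z u + a₂ * pi2 g φ x y z u + a₃ * pi3 g φ x y z u + a₄ * pi4 g η x y z u
    + a₅ * pi5 g φ η x y z u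

namespace IsAlmostContact

variable {g : E →L[ℝ] E →L[ℝ] ℝ} {φ : E →L[ℝ] E} {η : E →L[ℝ] ℝ} {ξ : E}
  (h : IsAlmostContact g φ η ξ)

include h

theorem phi_xi : φ ξ = 0 := by
  have h1 : φ (φ ξ) = 0 := by rw [h.sq, h.unit]; simp
  have h2 := h.sq (φ ξ)
  rw [h1, map_zero] at h2
  have h3 : φ ξ = η (φ ξ) • ξ := by linear_combination (norm := module) h2
  have h4 : η (φ ξ) * η (φ ξ) = 0 := by
    have := congrArg η h1
    rw [h3, map_smul] at this
    simpa using this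
  rw [h3, mul_self_eq_zero.1 h4, zero_smul]

theorem eta_phi (x : E) : η (φ x) = 0 := by
  rw [h.eta, h.self_adjoint, h.phi_xi, map_zero]

theorem ext {v w : E} (hvw : ∀ y, g v y = g w y) : v = w := by
  rw [← sub_eq_zero]
  exact h.nondeg _ fun y => by simp [hvw]

theorem phi_cube (x : E) : φ (φ (φ x)) = -φ x := by
  rw [h.sq, h.eta_phi, zero_smul, add_zero]

/-- The shape operator `A` of a hypersurface of class `F₄ ⊕ F₅`. Here `c = cos t`, `s = sin t`,
and `hF` expresses the covariant derivative of `φ` by `A`. -/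
theorem shape_operator {A : E →L[ℝ] E} (hA : ∀ x y, g (A x) y = g x (A y))
    {c s a b : ℝ} (hcs : c ^ 2 + s ^ 2 = 1) {F : E → E → E → ℝ}
    (hF : ∀ x y z, F x y z = g (-c • A x + s • φ (A x)) y * η z
      + g (-c • A x + s • φ (A x)) z * η y + 2 * c * η (A x) * η y * η z)
    (hS : ∀ x y z, F x y z = -a * (g (φ x) (φ y) * η z + g (φ x) (φ z) * η y)
      - b * (g x (φ y) * η z + g x (φ z) * η y)) (x : E) :
    A x = (η (A ξ) * η x) • ξ + (a * c + b * s) • φ (φ x) - (a * s - b * c) • φ x := by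
  -- compare the two expressions of `F` at `z = ξ`
  have h1 : ∀ x, -c • A x + s • φ (A x) + (c * η (A x)) • ξ = -a • φ (φ x) - b • φ x := by
    intro x
    refine h.ext fun y => ?_
    have e := (hF x y ξ).symm.trans (hS x y ξ)
    have e1 : g (A x) ξ = η (A x) := (h.eta _).symm
    have e2 : g (φ (A x)) ξ = 0 := by rw [← h.eta, h.eta_phi]
    have e3 : g ξ y = η y := by rw [h.symm, h.eta]
    simp only [map_add, map_smul, map_sub, add_apply, smul_apply, sub_apply, smul_eq_mul, h.unit,
      h.phi_xi, map_zero, e1, e2, e3, h.self_adjoint] at e ⊢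
    linear_combination e
  -- apply `-c - s φ`, the inverse of `-c + s φ` on the complement of `ξ`
  have h2 : ∀ x, A x = η (A x) • ξ + (a * c + b * s) • φ (φ x) - (a * s - b * c) • φ x := by
    intro x
    have e1 := h1 x
    have e2 := congrArg φ e1
    simp only [map_add, map_sub, map_smul, h.phi_xi, h.phi_cube, h.sq (A x)] at e2
    linear_combination (norm := module) (-c) • e1 - s • e2 - hcs • A x + hcs • (η (A x) • ξ)
  have h3 : A ξ = η (A ξ) • ξ := by
    have := h2 ξ
    simpa [h.phi_xi] using this
  rw [h2 x]
  congr 3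
  rw [h.eta (A x), hA, h3, map_smul, smul_eq_mul, ← h.eta x]
  simp [h.unit]

/-- The Gauss equation for a shape operator of class `F₄ ⊕ F₅` in a space of constant totally
real sectional curvatures `ν, νt`. `H` is the restriction to tangent vectors of the twin
`g'(·, J ·)` of the ambient metric; here `T = tan t`. -/
theorem gauss_formula {A : E →L[ℝ] E} {κ p q : ℝ}
    (hA : ∀ x, A x = (κ * η x) • ξ + p • φ (φ x) - q • φ x) {R : E → E → E → E → ℝ} {ν νt T : ℝ}
    {H : E → E → ℝ} (hH : ∀ x y, H x y = g x (φ y) + T * η x * η y)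
    (hR : ∀ x y z u, R x y z u =
      ν * (g y z * g x u - g x z * g y u - (H y z * H x u - H x z * H y u))
      + νt * (-(g y z * H x u) + g x z * H y u - H y z * g x u + H x z * g y u)
      - (g (A y) z * g (A x) u - g (A x) z * g (A y) u)) (x y z u : E) :
    R x y z u = piSum g φ η (ν - p ^ 2) (-ν - q ^ 2) (νt + p * q)
      (-νt * T + κ * p + p ^ 2) (-ν * T + κ * q + p * q) x y z u := by
  have hg : ∀ x y, g (A x) y = κ * η x * η y + p * (-g x y + η x * η y) - q * g x (φ y) := by
    intro x y
    rw [hA, h.sq]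
    have e3 : g ξ y = η y := by rw [h.symm, h.eta]
    simp [e3, h.self_adjoint]
    ring
  rw [hR]
  simp only [hg, hH, piSum, pi1, pi2, pi3, pi4, pi5]
  ring

/-! ### Scalar and sectional curvatures of combinations of `π₁, …, π₅` -/

theorem trace_phi [FiniteDimensional ℝ E] : LinearMap.trace ℝ E φ.toLinearMap = 0 :=
  trace_eq_zero_of_cube _ h.phi_cube

theorem trace_eta_xi [FiniteDimensional ℝ E] :
    LinearMap.trace ℝ E (η.toLinearMap.smulRight ξ) = 1 := by
  simp [h.unit]

theorem trace_phi_sq [FiniteDimensional ℝ E] :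
    LinearMap.trace ℝ E (φ.toLinearMap ∘ₗ φ.toLinearMap) = 1 - Module.finrank ℝ E := by
  have e : φ.toLinearMap ∘ₗ φ.toLinearMap = η.toLinearMap.smulRight ξ - LinearMap.id := by
    ext x; simp [h.sq, sub_eq_neg_add]
  rw [e, map_sub, h.trace_eta_xi, LinearMap.trace_id]

theorem scalar_piSum [FiniteDimensional ℝ E] {n : ℕ} (hn : Module.finrank ℝ E = 2 * n + 1)
    (a₁ a₂ a₃ a₄ a₅ : ℝ) : scalar g (piSum g φ η a₁ a₂ a₃ a₄ a₅) =
      2 * n * (2 * n + 1) * a₁ + 2 * n * a₂ + 4 * n * a₄ := by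
  set I : E →ₗ[ℝ] E := LinearMap.id with hI
  set f : E →ₗ[ℝ] E := φ.toLinearMap with hf
  set e : E →ₗ[ℝ] E := η.toLinearMap.smulRight ξ with he
  have hxi : ∀ y, g ξ y = η y := fun y => by rw [h.symm, h.eta]
  have sI : ∀ x y, g (I x) y = g x (I y) := fun _ _ => rfl
  have sf : ∀ x y, g (f x) y = g x (f y) := h.self_adjoint
  have se : ∀ x y, g (e x) y = g x (e y) := fun x y => by simp [he, hxi, ← h.eta, mul_comm]
  -- the tensors `K P Q` span the `π₁, …, π₅`, and their scalar curvatures are traces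
  let K (P Q : E →ₗ[ℝ] E) (x y z u : E) : ℝ := g (P y) z * g (Q x) u - g (P x) z * g (Q y) u
  have hK : piSum g φ η a₁ a₂ a₃ a₄ a₅ = fun x y z u => a₁ * K I I x y z u + a₂ * K f f x y z u
      + (-a₃) * K I f x y z u + (-a₃) * K f I x y z u + a₄ * K e I x y z u + a₄ * K I e x y z u
      + a₅ * K e f x y z u + a₅ * K f e x y z u := by
    funext x y z u
    simp only [piSum, pi1, pi2, pi3, pi4, pi5, K, hI, hf, he, LinearMap.id_apply,
      LinearMap.smulRight_apply, ContinuousLinearMap.coe_coe, map_smul, smul_apply, smul_eq_mul,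
      hxi, h.self_adjoint]
    ring
  have cI : ∀ P : E →ₗ[ℝ] E, I ∘ₗ P = P := fun _ => rfl
  have cI' : ∀ P : E →ₗ[ℝ] E, P ∘ₗ I = P := fun _ => rfl
  have cfe : f ∘ₗ e = 0 := by ext x; simp [he, hf, h.phi_xi]
  have cef : e ∘ₗ f = 0 := by ext x; simp [he, hf, h.eta_phi]
  have tI : LinearMap.trace ℝ E I = 2 * n + 1 := by
    rw [hI, LinearMap.trace_id, hn]; push_cast; ring
  have tff := h.trace_phi_sq
  have te := h.trace_eta_xi
  have tf := h.trace_phi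
  rw [hn] at tff
  push_cast at tff
  rw [← hf] at tf tff
  rw [← he] at te
  rw [hK]
  simp only [scalar_add, scalar_const_mul, K, scalar_endo h.symm h.nondeg _ _ sI,
    scalar_endo h.symm h.nondeg _ _ sf, scalar_endo h.symm h.nondeg _ _ se, cI, cI', cfe, cef,
    map_zero, tI, tf, te, tff]
  ring

/-- The associated scalar curvature of a combination of `π₁, …, π₅`. -/
theorem scalar_piSum_phi [FiniteDimensional ℝ E] {n : ℕ} (hn : Module.finrank ℝ E = 2 * n + 1)
    (a₁ a₂ a₃ a₄ a₅ : ℝ) :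
    scalar g (fun x y z u => piSum g φ η a₁ a₂ a₃ a₄ a₅ x y z (φ u)) =
      2 * n * (2 * n - 1) * a₃ - 2 * n * a₅ := by
  set I : E →ₗ[ℝ] E := LinearMap.id with hI
  set f : E →ₗ[ℝ] E := φ.toLinearMap with hf
  set e : E →ₗ[ℝ] E := η.toLinearMap.smulRight ξ with he
  have hxi : ∀ y, g ξ y = η y := fun y => by rw [h.symm, h.eta]
  have sI : ∀ x y, g (I x) y = g x (I y) := fun _ _ => rfl
  have sf : ∀ x y, g (f x) y = g x (f y) := h.self_adjoint
  have se : ∀ x y, g (e x) y = g x (e y) := fun x y => by simp [he, hxi, ← h.eta, mul_comm]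
  let K (P Q : E →ₗ[ℝ] E) (x y z u : E) : ℝ := g (P y) z * g (Q x) u - g (P x) z * g (Q y) u
  have hK : (fun x y z u => piSum g φ η a₁ a₂ a₃ a₄ a₅ x y z (φ u)) =
      fun x y z u => a₁ * K I f x y z u + a₂ * K f (f ∘ₗ f) x y z u
      + (-a₃) * K I (f ∘ₗ f) x y z u + (-a₃) * K f f x y z u + a₄ * K e f x y z u
      + a₅ * K e (f ∘ₗ f) x y z u := by
    funext x y z u
    simp only [piSum, pi1, pi2, pi3, pi4, pi5, K, hI, hf, he, LinearMap.id_apply,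
      LinearMap.smulRight_apply, LinearMap.comp_apply, ContinuousLinearMap.coe_coe, map_smul,
      smul_apply, smul_eq_mul, hxi, h.self_adjoint, h.eta_phi]
    ring
  have cI : ∀ P : E →ₗ[ℝ] E, I ∘ₗ P = P := fun _ => rfl
  have cef : e ∘ₗ f = 0 := by ext x; simp [he, hf, h.eta_phi]
  have ceff : e ∘ₗ f ∘ₗ f = 0 := by rw [← LinearMap.comp_assoc, cef, LinearMap.zero_comp]
  have cfff : f ∘ₗ f ∘ₗ f = -f := by ext x; simp [hf, h.phi_cube]
  have tI : LinearMap.trace ℝ E I = 2 * n + 1 := by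
    rw [hI, LinearMap.trace_id, hn]; push_cast; ring
  have tff := h.trace_phi_sq
  have te := h.trace_eta_xi
  have tf := h.trace_phi
  rw [hn] at tff
  push_cast at tff
  rw [← hf] at tf tff
  rw [← he] at te
  rw [hK]
  simp only [scalar_add, scalar_const_mul, K, scalar_endo h.symm h.nondeg _ _ sI,
    scalar_endo h.symm h.nondeg _ _ sf, scalar_endo h.symm h.nondeg _ _ se, cI, cef, ceff, cfff,
    map_zero, map_neg, tI, tf, te, tff]
  ring

/-- A nondegenerate section that is invariant under `φ` is orthogonal to `ξ`, and `φ` has trace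
`0` and determinant `1` on it. -/
theorem sectional_piSum_holomorphic (a₁ a₂ a₃ a₄ a₅ : ℝ) {x y : E}
    (hxy : IsNondegenerateSection g x y) (hφ : IsHolomorphicSection φ x y) :
    sectional g x y (piSum g φ η a₁ a₂ a₃ a₄ a₅) = a₁ + a₂ := by
  have hηs : ∀ v ∈ Submodule.span ℝ {x, y}, η v = 0 := by
    intro v hv
    rw [← hφ] at hv
    obtain ⟨w, -, rfl⟩ := hv
    exact h.eta_phi w
  have hηx : η x = 0 := hηs x (Submodule.subset_span (by simp))
  have hηy : η y = 0 := hηs y (Submodule.subset_span (by simp))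
  have hmem : ∀ v ∈ Submodule.span ℝ {x, y}, φ v ∈ Submodule.span ℝ {x, y} := by
    intro v hv
    rw [← hφ]
    exact Submodule.mem_map_of_mem hv
  obtain ⟨a, b, hab⟩ := Submodule.mem_span_pair.1 (hmem x (Submodule.subset_span (by simp)))
  obtain ⟨c, d, hcd⟩ := Submodule.mem_span_pair.1 (hmem y (Submodule.subset_span (by simp)))
  have hD : g y y * g x x - g x y * g y x ≠ 0 := hxy
  have hind : ∀ p q : ℝ, p • x + q • y = 0 → p = 0 ∧ q = 0 := by
    intro p q hpq
    have e1 : p * g x x + q * g y x = 0 := by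
      have := congrArg (fun v => g v x) hpq
      simpa using this
    have e2 : p * g x y + q * g y y = 0 := by
      have := congrArg (fun v => g v y) hpq
      simpa using this
    refine ⟨(mul_eq_zero.1 (?_ : p * (g y y * g x x - g x y * g y x) = 0)).resolve_right hD,
      (mul_eq_zero.1 (?_ : q * (g y y * g x x - g x y * g y x) = 0)).resolve_right hD⟩
    · linear_combination g y y * e1 - g y x * e2
    · linear_combination g x x * e2 - g x y * e1
  have hx2 : (a * a + b * c + 1) • x + (b * (a + d)) • y = 0 := by
    have e := h.sq x
    rw [hηx, zero_smul, add_zero, ← hab, map_add, map_smul, map_smul, ← hab, ← hcd] at e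
    linear_combination (norm := module) e
  have hy2 : (c * (a + d)) • x + (b * c + d * d + 1) • y = 0 := by
    have e := h.sq y
    rw [hηy, zero_smul, add_zero, ← hcd, map_add, map_smul, map_smul, ← hab, ← hcd] at e
    linear_combination (norm := module) e
  obtain ⟨h1, h2⟩ := hind _ _ hx2
  have hb : b ≠ 0 := by
    rintro rfl
    nlinarith [mul_self_nonneg a]
  have hd : d = -a := by linarith [(mul_eq_zero.1 h2).resolve_left hb]
  subst hd
  rw [sectional, div_eq_iff hxy]
  simp only [piSum, pi1, pi2, pi3, pi4, pi5, ← hab, ← hcd, hηx, hηy, map_add, map_smul,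
    smul_eq_mul, h.symm y x]
  linear_combination (-a₂ * (g y y * g x x - g x y * g x y)) * h1

theorem sectional_piSum_totallyReal (a₁ a₂ a₃ a₄ a₅ : ℝ) {x y : E}
    (hxy : IsNondegenerateSection g x y) (hφ : IsTotallyRealSection g φ x y)
    (hx : η x = 0) (hy : η y = 0) : sectional g x y (piSum g φ η a₁ a₂ a₃ a₄ a₅) = a₁ := by
  obtain ⟨h1, h2, h3, h4⟩ := hφ
  rw [h.self_adjoint] at h1 h2 h3 h4
  rw [sectional, div_eq_iff hxy]
  simp [piSum, pi1, pi2, pi3, pi4, pi5, h1, h2, h3, h4, hx, hy]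

end IsAlmostContact

end AlmostContact

open Filter Topology

-- instances on nested spaces of continuous linear maps, such as `E →L[ℝ] E →L[ℝ] E →L[ℝ] ℝ`
set_option maxSynthPendingDepth 3

/-! ### Directional derivatives of products -/

section LineDeriv

variable {E F H : Type*} [NormedAddCommGroup E] [NormedSpace ℝ E] [NormedAddCommGroup F]
  [NormedSpace ℝ F] [NormedAddCommGroup H] [NormedSpace ℝ H] {a v : E}

theorem _root_.HasLineDerivAt.clm_apply {c : E → F →L[ℝ] H} {c' : F →L[ℝ] H} {u : E → F} {u' : F}
    (hc : HasLineDerivAt ℝ c c' a v) (hu : HasLineDerivAt ℝ u u' a v) :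
    HasLineDerivAt ℝ (fun y => c y (u y)) (c' (u a) + c a u') a v := by
  simpa [HasLineDerivAt] using HasDerivAt.clm_apply hc hu

theorem _root_.HasLineDerivAt.add {f g : E → F} {f' g' : F} (hf : HasLineDerivAt ℝ f f' a v)
    (hg : HasLineDerivAt ℝ g g' a v) : HasLineDerivAt ℝ (fun y => f y + g y) (f' + g') a v :=
  HasDerivAt.add hf hg

theorem _root_.HasLineDerivAt.sub {f g : E → F} {f' g' : F} (hf : HasLineDerivAt ℝ f f' a v)
    (hg : HasLineDerivAt ℝ g g' a v) : HasLineDerivAt ℝ (fun y => f y - g y) (f' - g') a v :=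
  HasDerivAt.sub hf hg

theorem _root_.HasLineDerivAt.neg {f : E → F} {f' : F} (hf : HasLineDerivAt ℝ f f' a v) :
    HasLineDerivAt ℝ (fun y => -f y) (-f') a v :=
  HasDerivAt.neg hf

theorem _root_.HasLineDerivAt.fun_smul {c : E → ℝ} {c' : ℝ} {f : E → F} {f' : F}
    (hc : HasLineDerivAt ℝ c c' a v) (hf : HasLineDerivAt ℝ f f' a v) :
    HasLineDerivAt ℝ (fun y => c y • f y) (c a • f' + c' • f a) a v := by
  simpa [HasLineDerivAt] using HasDerivAt.fun_smul hc hf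

theorem _root_.HasLineDerivAt.mul {c f : E → ℝ} {c' f' : ℝ}
    (hc : HasLineDerivAt ℝ c c' a v) (hf : HasLineDerivAt ℝ f f' a v) :
    HasLineDerivAt ℝ (fun y => c y * f y) (c' * f a + c a * f') a v := by
  simpa [HasLineDerivAt] using HasDerivAt.fun_mul hc hf

theorem hasLineDerivAt_const (x : F) : HasLineDerivAt ℝ (fun _ : E => x) 0 a v :=
  hasDerivAt_const _ _

theorem _root_.ContDiffAt.hasLineDerivAt {f : E → F} (hf : ContDiffAt ℝ ∞ f a) (v : E) :
    HasLineDerivAt ℝ f (fderiv ℝ f a v) a v :=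
  (hf.differentiableAt (by simp)).hasFDerivAt.hasLineDerivAt v

theorem _root_.ContDiffAt.hasLineDerivAt_comp {f : F → H} {h : E → F}
    (hf : ContDiffAt ℝ ∞ f (h a)) (hh : ContDiffAt ℝ ∞ h a) (v : E) :
    HasLineDerivAt ℝ (fun y => f (h y)) (fderiv ℝ f (h a) (fderiv ℝ h a v)) a v :=
  ((hf.differentiableAt (by simp)).hasFDerivAt.comp a
    (hh.differentiableAt (by simp)).hasFDerivAt).hasLineDerivAt v

theorem _root_.ContDiffAt.fderiv_infty {f : E → F} (hf : ContDiffAt ℝ ∞ f a) :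
    ContDiffAt ℝ ∞ (fderiv ℝ f) a :=
  hf.fderiv_right (by simp)

theorem _root_.ContDiffAt.fderiv_fderiv_comm {f : E → F} (hf : ContDiffAt ℝ ∞ f a) (v w : E) :
    fderiv ℝ (fderiv ℝ f) a v w = fderiv ℝ (fderiv ℝ f) a w v :=
  hf.isSymmSndFDerivAt (by simp; exact WithTop.coe_le_coe.2 le_top) v w

end LineDeriv

/-! ### The Levi-Civita connection of a metric in coordinates -/

section Christoffel

variable {E : Type*} [NormedAddCommGroup E] [NormedSpace ℝ E]

/-- `G` is a smooth symmetric nondegenerate metric in a neighbourhood of `a`. -/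
structure IsMetricNear (G : E → E →L[ℝ] E →L[ℝ] ℝ) (a : E) : Prop where
  smooth : ∀ᶠ y in 𝓝 a, ContDiffAt ℝ ∞ G y
  symm : ∀ᶠ y in 𝓝 a, ∀ v w, G y v w = G y w v
  invertible : ∀ᶠ y in 𝓝 a, (G y).IsInvertible

/-- The Christoffel symbols as a field of bilinear maps. -/
def christoffelL (G : E → E →L[ℝ] E →L[ℝ] ℝ) (y : E) : E →L[ℝ] E →L[ℝ] E :=
  (ContinuousLinearMap.compL ℝ E (E →L[ℝ] ℝ) E (sharp (G y))).comp
    ((1 / 2 : ℝ) • (fderiv ℝ G y + (fderiv ℝ G y).flip -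
      (ContinuousLinearMap.flipₗᵢ ℝ E E ℝ).toContinuousLinearEquiv.toContinuousLinearMap.comp
        (fderiv ℝ G y).flip))

theorem christoffelL_apply (G : E → E →L[ℝ] E →L[ℝ] ℝ) (y v w : E) :
    christoffelL G y v w = christoffel G y v w := rfl

namespace IsMetricNear

variable {G : E → E →L[ℝ] E →L[ℝ] ℝ} {a : E} (hG : IsMetricNear G a)

include hG

theorem eventually : ∀ᶠ y in 𝓝 a, IsMetricNear G y := by
  filter_upwards [hG.smooth.eventually_nhds, hG.symm.eventually_nhds,
    hG.invertible.eventually_nhds] with y h1 h2 h3 using ⟨h1, h2, h3⟩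

theorem ext {v w : E} (h : ∀ u, G a v u = G a w u) : v = w :=
  hG.invertible.self_of_nhds.injective (ContinuousLinearMap.ext h)

theorem koszul (v w u : E) : G a (christoffelL G a v w) u =
    (fderiv ℝ G a v w u + fderiv ℝ G a w v u - fderiv ℝ G a u v w) / 2 := by
  rw [christoffelL_apply, christoffel, apply_sharp hG.invertible.self_of_nhds]
  simp
  ring

theorem fderiv_symm (u v w : E) : fderiv ℝ G a u v w = fderiv ℝ G a u w v := by
  have h := hG.smooth.self_of_nhds.hasLineDerivAt u
  have h1 := (h.clm_apply (hasLineDerivAt_const v)).clm_apply (hasLineDerivAt_const w)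
  have h2 := (h.clm_apply (hasLineDerivAt_const w)).clm_apply (hasLineDerivAt_const v)
  have := h1.unique (h2.congr_of_eventuallyEq (by
    filter_upwards [hG.symm] with y hy using hy v w))
  simpa using this

theorem christoffelL_comm (v w : E) : christoffelL G a v w = christoffelL G a w v := by
  refine hG.ext fun u => ?_
  rw [hG.koszul, hG.koszul, hG.fderiv_symm u v w]
  ring

/-- The Levi-Civita connection is metric. -/
theorem fderiv_apply (v w u : E) : fderiv ℝ G a v w u =
    G a (christoffelL G a v w) u + G a w (christoffelL G a v u) := by
  rw [hG.symm.self_of_nhds w, hG.koszul, hG.koszul, hG.fderiv_symm w v u, hG.fderiv_symm u v w,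
    hG.fderiv_symm v u w]
  ring

theorem contDiffAt_christoffelL [FiniteDimensional ℝ E] : ContDiffAt ℝ ∞ (christoffelL G) a := by
  have h1 := hG.smooth.self_of_nhds
  have h2 := h1.fderiv_infty
  have h3 : ContDiffAt ℝ ∞ (fun y => (fderiv ℝ G y).flip) a :=
    h2.continuousLinearMap_comp
      (ContinuousLinearMap.flipₗᵢ ℝ E E
        (E →L[ℝ] ℝ)).toContinuousLinearEquiv.toContinuousLinearMap
  have h4 : ContDiffAt ℝ ∞ (fun y => sharp (G y)) a :=
    (hG.invertible.self_of_nhds.contDiffAt_map_inverse).comp a h1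
  unfold christoffelL
  refine ContDiffAt.clm_comp (h4.continuousLinearMap_comp _) ?_
  exact ((h2.add h3).sub (contDiffAt_const.clm_comp h3)).const_smul _

/-- The curvature in terms of the derivatives of the Christoffel symbols. -/
theorem coordCurvature_eq [FiniteDimensional ℝ E] (v w z : E) : coordCurvature G a v w z =
    fderiv ℝ (christoffelL G) a v w z - fderiv ℝ (christoffelL G) a w v z
      + christoffelL G a v (christoffelL G a w z)
      - christoffelL G a w (christoffelL G a v z) := by
  have hd : ∀ w z v, fderiv ℝ (fun y => christoffel G y w z) a v =
      fderiv ℝ (christoffelL G) a v w z := by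
    intro w z v
    have h := (hG.contDiffAt_christoffelL.differentiableAt (by simp)).hasFDerivAt
    have h1 := (h.clm_apply (hasFDerivAt_const w a)).clm_apply (hasFDerivAt_const z a)
    have h2 : HasFDerivAt (fun y => christoffel G y w z) _ a := h1
    rw [h2.fderiv]
    simp
  simp only [coordCurvature, hd]
  rfl

theorem coordCurvature_bianchi [FiniteDimensional ℝ E] (v w z : E) : coordCurvature G a v w z
    + coordCurvature G a w z v + coordCurvature G a z v w = 0 := by
  have hd : ∀ u v w, fderiv ℝ (christoffelL G) a u v w = fderiv ℝ (christoffelL G) a u w v := by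
    intro u v w
    have h := hG.contDiffAt_christoffelL.hasLineDerivAt u
    have h1 := (h.clm_apply (hasLineDerivAt_const v)).clm_apply (hasLineDerivAt_const w)
    have h2 := (h.clm_apply (hasLineDerivAt_const w)).clm_apply (hasLineDerivAt_const v)
    have := h1.unique (h2.congr_of_eventuallyEq (by
      filter_upwards [hG.eventually] with y hy using hy.christoffelL_comm v w))
    simpa using this
  simp only [hG.coordCurvature_eq]
  rw [hd v w z, hd w z v, hd z v w, hG.christoffelL_comm w z, hG.christoffelL_comm v z,
    hG.christoffelL_comm w v]
  abel

theorem coordCurvature_skew [FiniteDimensional ℝ E] (v w z u : E) :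
    G a (coordCurvature G a v w z) u = -G a (coordCurvature G a v w u) z := by
  have key : ∀ v w, fderiv ℝ (fderiv ℝ G) a v w z u =
      G a (christoffelL G a v (christoffelL G a w z)) u
      + G a (christoffelL G a w z) (christoffelL G a v u)
      + G a (fderiv ℝ (christoffelL G) a v w z) u
      + (G a (christoffelL G a v z) (christoffelL G a w u)
      + G a z (christoffelL G a v (christoffelL G a w u))
      + G a z (fderiv ℝ (christoffelL G) a v w u)) := by
    intro v w
    have hg := hG.smooth.self_of_nhds.hasLineDerivAt v
    have hgg := hG.smooth.self_of_nhds.fderiv_infty.hasLineDerivAt v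
    have hc := hG.contDiffAt_christoffelL.hasLineDerivAt v
    have hcz := (hc.clm_apply (hasLineDerivAt_const w)).clm_apply (hasLineDerivAt_const z)
    have hcu := (hc.clm_apply (hasLineDerivAt_const w)).clm_apply (hasLineDerivAt_const u)
    have h1 := ((hgg.clm_apply (hasLineDerivAt_const w)).clm_apply
      (hasLineDerivAt_const z)).clm_apply (hasLineDerivAt_const u)
    have h2 := ((hg.clm_apply hcz).clm_apply (hasLineDerivAt_const u)).add
      ((hg.clm_apply (hasLineDerivAt_const z)).clm_apply hcu)
    have := h1.unique (h2.congr_of_eventuallyEq (by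
      filter_upwards [hG.eventually] with y hy using hy.fderiv_apply w z u))
    simpa [hG.fderiv_apply] using this
  have h := hG.smooth.self_of_nhds.fderiv_fderiv_comm v w
  have h' := congrArg (fun B => B z u) h
  simp only [key] at h'
  have hs := hG.symm.self_of_nhds
  simp only [hG.coordCurvature_eq, map_add, map_sub, add_apply, sub_apply]
  simp only [hs z] at h'
  linear_combination h'

theorem isCurvatureLike [FiniteDimensional ℝ E] :
    IsCurvatureLike fun x y z u => G a (coordCurvature G a x y z) u where
  add x x' y z u := by
    simp only [hG.coordCurvature_eq, map_add, add_apply, map_sub, sub_apply]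
    ring
  smul c x y z u := by
    simp only [hG.coordCurvature_eq, map_smul, smul_apply, map_sub, sub_apply, map_add, add_apply,
      smul_eq_mul]
    ring
  skew x y z u := by simp only [hG.coordCurvature_eq, map_sub, sub_apply, map_add, add_apply]; ring
  skew' x y z u := hG.coordCurvature_skew x y z u
  bianchi x y z u := by
    simp only [← add_apply, ← map_add, hG.coordCurvature_bianchi]
    simp

/-- If `∇J = 0`, then the curvature operators commute with `J`. -/
theorem coordCurvature_parallel [FiniteDimensional ℝ E] {J : E → E →L[ℝ] E}
    (hJ : ∀ᶠ y in 𝓝 a, ContDiffAt ℝ ∞ J y)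
    (hpar : ∀ᶠ y in 𝓝 a, ∀ v w, coordCovDeriv G J y v w = 0) (v w z : E) :
    coordCurvature G a v w (J a z) = J a (coordCurvature G a v w z) := by
  have h0 : ∀ᶠ y in 𝓝 a, ∀ w z, fderiv ℝ J y w z =
      J y (christoffelL G y w z) - christoffelL G y w (J y z) := by
    filter_upwards [hpar] with y hy w z
    have := hy w z
    simp only [coordCovDeriv, ← christoffelL_apply] at this
    linear_combination (norm := module) this
  have h0a := h0.self_of_nhds
  have key : ∀ v w, fderiv ℝ (fderiv ℝ J) a v w z =
      (fderiv ℝ J a v (christoffelL G a w z) + J a (fderiv ℝ (christoffelL G) a v w z))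
      - (fderiv ℝ (christoffelL G) a v w (J a z) + christoffelL G a w (fderiv ℝ J a v z)) := by
    intro v w
    have hj := hJ.self_of_nhds.hasLineDerivAt v
    have hjj := hJ.self_of_nhds.fderiv_infty.hasLineDerivAt v
    have hc := (hG.contDiffAt_christoffelL.hasLineDerivAt v).clm_apply (hasLineDerivAt_const w)
    have h1 := (hjj.clm_apply (hasLineDerivAt_const w)).clm_apply (hasLineDerivAt_const z)
    have h2 := (hj.clm_apply (hc.clm_apply (hasLineDerivAt_const z))).sub
      (hc.clm_apply (hj.clm_apply (hasLineDerivAt_const z)))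
    have := h1.unique (h2.congr_of_eventuallyEq (by
      filter_upwards [h0] with y hy using hy w z))
    simpa using this
  have h' := congrArg (fun B => B z) (hJ.self_of_nhds.fderiv_fderiv_comm v w)
  simp only [key, h0a, map_sub] at h'
  simp only [hG.coordCurvature_eq, map_add, map_sub]
  linear_combination (norm := module) -h'

end IsMetricNear

end Christoffel

/-! ### Immersions in coordinates -/

section Pullback

variable {E E' : Type*} [NormedAddCommGroup E] [NormedSpace ℝ E]
  [NormedAddCommGroup E'] [NormedSpace ℝ E']

/-- `h` is a smooth map near `a` that is isometric for the metrics `G` and `G'`. -/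
structure IsIsometryNear (G : E → E →L[ℝ] E →L[ℝ] ℝ) (G' : E' → E' →L[ℝ] E' →L[ℝ] ℝ)
    (h : E → E') (a : E) : Prop where
  metric : IsMetricNear G a
  metric' : IsMetricNear G' (h a)
  smooth : ∀ᶠ y in 𝓝 a, ContDiffAt ℝ ∞ h y
  pullback : ∀ᶠ y in 𝓝 a, ∀ v w, G y v w = G' (h y) (fderiv ℝ h y v) (fderiv ℝ h y w)

/-- The acceleration `∇'_v (dh w) = D²h(v, w) + Γ'(dh v, dh w)` of the coordinate fields. -/
def accel (G' : E' → E' →L[ℝ] E' →L[ℝ] ℝ) (h : E → E') (y v w : E) : E' :=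
  fderiv ℝ (fderiv ℝ h) y v w + christoffelL G' (h y) (fderiv ℝ h y v) (fderiv ℝ h y w)

/-- The vector `Z` is the covariant derivative in direction `v`, at `a`, of the field `X` along
the map `h`. -/
def HasCovDerivAt (G' : E' → E' →L[ℝ] E' →L[ℝ] ℝ) (h : E → E') (X : E → E') (Z : E') (a v : E) :
    Prop :=
  HasLineDerivAt ℝ X (Z - christoffelL G' (h a) (fderiv ℝ h a v) (X a)) a v

namespace HasCovDerivAt

variable {G' : E' → E' →L[ℝ] E' →L[ℝ] ℝ} {h : E → E'} {X Y : E → E'} {Z W : E'} {a v : E}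

theorem of_hasLineDerivAt {X' : E'} (hX : HasLineDerivAt ℝ X X' a v) :
    HasCovDerivAt G' h X (X' + christoffelL G' (h a) (fderiv ℝ h a v) (X a)) a v := by
  simpa [HasCovDerivAt] using hX

theorem unique (hX : HasCovDerivAt G' h X Z a v) (hX' : HasCovDerivAt G' h X W a v) : Z = W :=
  sub_left_injective (HasLineDerivAt.unique hX hX')

theorem congr (hX : HasCovDerivAt G' h X Z a v) (hXY : X =ᶠ[𝓝 a] Y) :
    HasCovDerivAt G' h Y Z a v := by
  have := HasLineDerivAt.congr_of_eventuallyEq hX hXY.symm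
  rwa [hXY.eq_of_nhds] at this

theorem add (hX : HasCovDerivAt G' h X Z a v) (hY : HasCovDerivAt G' h Y W a v) :
    HasCovDerivAt G' h (fun y => X y + Y y) (Z + W) a v := by
  have := HasLineDerivAt.add hX hY
  unfold HasCovDerivAt
  convert this using 1
  rw [map_add]; abel

theorem smul {c : E → ℝ} {c' : ℝ} (hc : HasLineDerivAt ℝ c c' a v)
    (hX : HasCovDerivAt G' h X Z a v) :
    HasCovDerivAt G' h (fun y => c y • X y) (c' • X a + c a • Z) a v := by
  have := HasLineDerivAt.fun_smul hc hX
  unfold HasCovDerivAt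
  convert this using 1
  rw [map_smul]; module

/-- The product rule for the metric. -/
theorem metric (hG : IsMetricNear G' (h a)) (hh : ContDiffAt ℝ ∞ h a)
    (hX : HasCovDerivAt G' h X Z a v) (hY : HasCovDerivAt G' h Y W a v) :
    HasLineDerivAt ℝ (fun y => G' (h y) (X y) (Y y)) (G' (h a) Z (Y a) + G' (h a) (X a) W) a v := by
  have := ((hG.smooth.self_of_nhds.hasLineDerivAt_comp hh v).clm_apply hX).clm_apply hY
  convert this using 1
  simp only [add_apply, hG.fderiv_apply, map_sub, sub_apply]
  ring

/-- A parallel endomorphism field commutes with covariant differentiation. -/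
theorem parallel {J : E' → E' →L[ℝ] E'} (hJ : ContDiffAt ℝ ∞ J (h a))
    (hpar : ∀ v w, coordCovDeriv G' J (h a) v w = 0) (hh : ContDiffAt ℝ ∞ h a)
    (hX : HasCovDerivAt G' h X Z a v) :
    HasCovDerivAt G' h (fun y => J (h y) (X y)) (J (h a) Z) a v := by
  have := (hJ.hasLineDerivAt_comp hh v).clm_apply hX
  have hp := hpar (fderiv ℝ h a v) (X a)
  simp only [coordCovDeriv, ← christoffelL_apply] at hp
  unfold HasCovDerivAt
  convert this using 1
  rw [map_sub]
  linear_combination (norm := module) -hp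

end HasCovDerivAt

namespace IsIsometryNear

variable {G : E → E →L[ℝ] E →L[ℝ] ℝ} {G' : E' → E' →L[ℝ] E' →L[ℝ] ℝ} {h : E → E'} {a : E}
  (hh : IsIsometryNear G G' h a)

include hh

theorem hasCovDerivAt_fderiv (v w : E) :
    HasCovDerivAt G' h (fun y => fderiv ℝ h y w) (accel G' h a v w) a v := by
  have h1 := (hh.smooth.self_of_nhds.fderiv_infty.hasLineDerivAt v).clm_apply
    (hasLineDerivAt_const w)
  simpa [accel] using HasCovDerivAt.of_hasLineDerivAt (G' := G') (h := h) h1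

theorem accel_comm (v w : E) : accel G' h a v w = accel G' h a w v := by
  rw [accel, accel, hh.smooth.self_of_nhds.fderiv_fderiv_comm, hh.metric'.christoffelL_comm]

/-- The tangential part of the acceleration is given by the Levi-Civita connection of the
induced metric. -/
theorem accel_tangential (v w u : E) :
    G' (h a) (accel G' h a v w) (fderiv ℝ h a u) = G a (christoffelL G a v w) u := by
  have key : ∀ v w u, fderiv ℝ G a v w u = G' (h a) (accel G' h a v w) (fderiv ℝ h a u)
      + G' (h a) (fderiv ℝ h a w) (accel G' h a v u) := by
    intro v w u
    have h1 := ((hh.metric.smooth.self_of_nhds.hasLineDerivAt v).clm_apply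
      (hasLineDerivAt_const w)).clm_apply (hasLineDerivAt_const u)
    have h2 := (hh.hasCovDerivAt_fderiv v w).metric hh.metric' hh.smooth.self_of_nhds
      (hh.hasCovDerivAt_fderiv v u)
    have := h1.unique (h2.congr_of_eventuallyEq (by
      filter_upwards [hh.pullback] with y hy using hy w u))
    simpa using this
  have hs := hh.metric'.symm.self_of_nhds
  rw [hh.metric.koszul, key, key, key, hh.accel_comm w v, hh.accel_comm u v, hh.accel_comm u w,
    hs (fderiv ℝ h a w), hs (fderiv ℝ h a v)]
  ring

/-- Invariance of the covariant derivative of an endomorphism field under local isometries. -/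
theorem coordCovDeriv_eq (hsurj : Function.Surjective (fderiv ℝ h a))
    {J : E → E →L[ℝ] E} {J' : E' → E' →L[ℝ] E'} (hJ : ContDiffAt ℝ ∞ J a)
    (hJ' : ContDiffAt ℝ ∞ J' (h a))
    (hJJ : ∀ᶠ y in 𝓝 a, ∀ w, fderiv ℝ h y (J y w) = J' (h y) (fderiv ℝ h y w)) (v w : E) :
    fderiv ℝ h a (coordCovDeriv G J a v w) =
      coordCovDeriv G' J' (h a) (fderiv ℝ h a v) (fderiv ℝ h a w) := by
  have hacc : ∀ v w, fderiv ℝ (fderiv ℝ h) a v w = fderiv ℝ h a (christoffelL G a v w)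
      - christoffelL G' (h a) (fderiv ℝ h a v) (fderiv ℝ h a w) := by
    intro v w
    rw [eq_sub_iff_add_eq]
    refine hh.metric'.ext fun u => ?_
    obtain ⟨u, rfl⟩ := hsurj u
    rw [← hh.pullback.self_of_nhds]
    exact hh.accel_tangential v w u
  have hd := hh.smooth.self_of_nhds.fderiv_infty.hasLineDerivAt v
  have h1 := hd.clm_apply ((hJ.hasLineDerivAt v).clm_apply (hasLineDerivAt_const w))
  have h2 := (hJ'.hasLineDerivAt_comp hh.smooth.self_of_nhds v).clm_apply
    (hd.clm_apply (hasLineDerivAt_const w))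
  have h3 := h1.unique (h2.congr_of_eventuallyEq (by
    filter_upwards [hJJ] with y hy using hy w))
  have hJa := hJJ.self_of_nhds
  simp only [map_zero, add_zero, hacc, hJa, map_sub] at h3
  simp only [coordCovDeriv, ← christoffelL_apply, map_add, map_sub, hJa]
  linear_combination (norm := module) h3

end IsIsometryNear

end Pullback

/-! ### Hypersurfaces in coordinates -/

section Hypersurface

variable {E E' : Type*} [NormedAddCommGroup E] [NormedSpace ℝ E]
  [NormedAddCommGroup E'] [NormedSpace ℝ E']

/-- `h` is an isometric immersion near `a` with unit time-like normal field `n`, whose normal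
spaces are spanned by `n`. -/
structure IsHypersurfaceNear (G : E → E →L[ℝ] E →L[ℝ] ℝ) (G' : E' → E' →L[ℝ] E' →L[ℝ] ℝ)
    (h : E → E') (n : E → E') (a : E) : Prop extends IsIsometryNear G G' h a where
  smooth_normal : ∀ᶠ y in 𝓝 a, ContDiffAt ℝ ∞ n y
  normal : ∀ᶠ y in 𝓝 a, ∀ v, G' (h y) (fderiv ℝ h y v) (n y) = 0
  timelike : ∀ᶠ y in 𝓝 a, G' (h y) (n y) (n y) = -1
  span : ∀ᶠ y in 𝓝 a, ∀ X, (∀ u, G' (h y) X (fderiv ℝ h y u) = 0) → G' (h y) X (n y) = 0 → X = 0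

/-- The second fundamental form: the `n`-component of the acceleration. -/
def secondForm (G' : E' → E' →L[ℝ] E' →L[ℝ] ℝ) (h : E → E') (n : E → E') (y v w : E) : ℝ :=
  -G' (h y) (accel G' h y v w) (n y)

/-- The covariant derivative `∇'_v n` of the normal. -/
def normalDeriv (G' : E' → E' →L[ℝ] E' →L[ℝ] ℝ) (h : E → E') (n : E → E') (y v : E) : E' :=
  fderiv ℝ n y v + christoffelL G' (h y) (fderiv ℝ h y v) (n y)

namespace IsHypersurfaceNear

variable {G : E → E →L[ℝ] E →L[ℝ] ℝ} {G' : E' → E' →L[ℝ] E' →L[ℝ] ℝ} {h n : E → E'} {a : E}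
  (hh : IsHypersurfaceNear G G' h n a)

include hh

theorem eventually : ∀ᶠ y in 𝓝 a, IsHypersurfaceNear G G' h n y := by
  have hc : ContinuousAt h a := (hh.smooth.self_of_nhds.differentiableAt (by simp)).continuousAt
  filter_upwards [hh.metric.eventually, hc.eventually hh.metric'.eventually,
    hh.smooth.eventually_nhds, hh.pullback.eventually_nhds, hh.smooth_normal.eventually_nhds,
    hh.normal.eventually_nhds, hh.timelike.eventually_nhds, hh.span.eventually_nhds]
    with y h1 h2 h3 h4 h5 h6 h7 h8 using ⟨⟨h1, h2, h3, h4⟩, h5, h6, h7, h8⟩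

/-- The Gauss formula. -/
theorem accel_eq (v w : E) : accel G' h a v w =
    fderiv ℝ h a (christoffelL G a v w) + secondForm G' h n a v w • n a := by
  have hn := hh.normal.self_of_nhds
  have hn' : ∀ u, G' (h a) (n a) (fderiv ℝ h a u) = 0 := fun u => by
    rw [hh.metric'.symm.self_of_nhds, hn]
  rw [← sub_eq_zero]
  refine hh.span.self_of_nhds _ (fun u => ?_) ?_
  · simp [hn', hh.accel_tangential, hh.pullback.self_of_nhds]
  · simp [hn, hh.timelike.self_of_nhds, secondForm]

theorem hasCovDerivAt_normal (v : E) : HasCovDerivAt G' h n (normalDeriv G' h n a v) a v :=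
  HasCovDerivAt.of_hasLineDerivAt (hh.smooth_normal.self_of_nhds.hasLineDerivAt v)

/-- The Weingarten formula. -/
theorem normalDeriv_tangential (v u : E) :
    G' (h a) (normalDeriv G' h n a v) (fderiv ℝ h a u) = secondForm G' h n a v u := by
  have h1 := (hh.hasCovDerivAt_fderiv v u).metric hh.metric' hh.smooth.self_of_nhds
    (hh.hasCovDerivAt_normal v)
  have h2 := h1.unique ((hasLineDerivAt_const (0 : ℝ)).congr_of_eventuallyEq (by
    filter_upwards [hh.normal] with y hy using hy u))
  rw [hh.metric'.symm.self_of_nhds, secondForm]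
  linear_combination h2

theorem normalDeriv_normal (v : E) : G' (h a) (normalDeriv G' h n a v) (n a) = 0 := by
  have h1 := (hh.hasCovDerivAt_normal v).metric hh.metric' hh.smooth.self_of_nhds
    (hh.hasCovDerivAt_normal v)
  have h2 := h1.unique ((hasLineDerivAt_const (-1 : ℝ)).congr_of_eventuallyEq hh.timelike)
  rw [hh.metric'.symm.self_of_nhds (n a)] at h2
  linarith

theorem secondForm_comm (v w : E) : secondForm G' h n a v w = secondForm G' h n a w v := by
  rw [secondForm, hh.accel_comm, secondForm]

/-- The covariant derivative of a tangent field. -/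
theorem hasCovDerivAt_tangent {Y : E → E} {Y' : E} {v : E} (hY : HasLineDerivAt ℝ Y Y' a v) :
    HasCovDerivAt G' h (fun y => fderiv ℝ h y (Y y))
      (fderiv ℝ h a (Y' + christoffelL G a v (Y a)) + secondForm G' h n a v (Y a) • n a) a v := by
  have h1 := (hh.smooth.self_of_nhds.fderiv_infty.hasLineDerivAt v).clm_apply hY
  have h2 := HasCovDerivAt.of_hasLineDerivAt (G' := G') (h := h) h1
  convert h2 using 1
  have := hh.accel_eq v (Y a)
  rw [accel] at this
  rw [map_add]
  linear_combination (norm := module) -this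

/-- The Gauss equation. -/
theorem gauss [FiniteDimensional ℝ E] [FiniteDimensional ℝ E'] (v w z u : E) :
    G' (h a) (coordCurvature G' (h a) (fderiv ℝ h a v) (fderiv ℝ h a w) (fderiv ℝ h a z))
      (fderiv ℝ h a u) = G a (coordCurvature G a v w z) u
        + secondForm G' h n a w z * secondForm G' h n a v u
        - secondForm G' h n a v z * secondForm G' h n a w u := by
  have hs := hh.smooth.self_of_nhds
  have hn := hh.normal.self_of_nhds
  have hn' : ∀ u, G' (h a) (n a) (fderiv ℝ h a u) = 0 := fun u => by
    rw [hh.metric'.symm.self_of_nhds, hn]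
  -- both sides compute the covariant derivative in direction `v` of the acceleration `(w, z)`
  have key : ∀ v w, G' (h a) (fderiv ℝ (fderiv ℝ (fderiv ℝ h)) a v w z
      + (fderiv ℝ (christoffelL G') (h a) (fderiv ℝ h a v) (fderiv ℝ h a w) (fderiv ℝ h a z)
        + christoffelL G' (h a) (fderiv ℝ (fderiv ℝ h) a v w) (fderiv ℝ h a z)
        + christoffelL G' (h a) (fderiv ℝ h a w) (fderiv ℝ (fderiv ℝ h) a v z))
      + christoffelL G' (h a) (fderiv ℝ h a v) (accel G' h a w z)) (fderiv ℝ h a u) =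
      G a (fderiv ℝ (christoffelL G) a v w z + christoffelL G a v (christoffelL G a w z)) u
        + secondForm G' h n a w z * secondForm G' h n a v u := by
    intro v w
    have d1 := hs.fderiv_infty.hasLineDerivAt v
    have d2 := hs.fderiv_infty.fderiv_infty.hasLineDerivAt v
    have dw := d1.clm_apply (hasLineDerivAt_const w)
    have dz := d1.clm_apply (hasLineDerivAt_const z)
    have dc := hh.metric'.contDiffAt_christoffelL.hasLineDerivAt_comp hs v
    have dacc := ((d2.clm_apply (hasLineDerivAt_const w)).clm_apply (hasLineDerivAt_const z)).add
      ((dc.clm_apply dw).clm_apply dz)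
    have c1 : HasCovDerivAt G' h (fun y => accel G' h y w z) _ a v :=
      HasCovDerivAt.of_hasLineDerivAt dacc
    have dII : HasLineDerivAt ℝ (fun y => secondForm G' h n y w z) _ a v :=
      (c1.metric hh.metric' hs (hh.hasCovDerivAt_normal v)).neg
    have dY := ((hh.metric.contDiffAt_christoffelL.hasLineDerivAt v).clm_apply
      (hasLineDerivAt_const w)).clm_apply (hasLineDerivAt_const z)
    have c2 := (hh.hasCovDerivAt_tangent dY).add (HasCovDerivAt.smul dII
      (hh.hasCovDerivAt_normal v))
    have c3 := c1.unique (c2.congr (by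
      filter_upwards [hh.eventually] with y hy using (hy.accel_eq w z).symm))
    have c4 := congrArg (fun X => G' (h a) X (fderiv ℝ h a u)) c3
    simp only [map_add, add_apply, map_smul, smul_apply, hn', hh.normalDeriv_tangential,
      ← hh.pullback.self_of_nhds, map_zero, smul_eq_mul, mul_zero, add_zero,
      zero_add] at c4 ⊢
    linear_combination c4
  have k1 := key v w
  have k2 := key w v
  have e1 := hs.fderiv_infty.fderiv_fderiv_comm v w
  have e2 := hs.fderiv_fderiv_comm v w
  rw [e1, e2] at k1
  rw [hh.metric'.coordCurvature_eq, hh.metric.coordCurvature_eq]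
  simp only [accel, map_add, map_sub, add_apply, sub_apply] at k1 k2 ⊢
  linear_combination k1 - k2

end IsHypersurfaceNear

end Hypersurface

/-! ### The covariant derivative of the induced structure -/

section InducedStructure

variable {E E' : Type*} [NormedAddCommGroup E] [NormedSpace ℝ E]
  [NormedAddCommGroup E'] [NormedSpace ℝ E']

theorem _root_.ContDiffAt.bilinearComp {G : E → E' →L[ℝ] E' →L[ℝ] ℝ} {P Q : E → E →L[ℝ] E'}
    {a : E} (hG : ContDiffAt ℝ ∞ G a) (hP : ContDiffAt ℝ ∞ P a) (hQ : ContDiffAt ℝ ∞ Q a) :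
    ContDiffAt ℝ ∞ (fun y => (G y).bilinearComp (P y) (Q y)) a := by
  have h1 : ContDiffAt ℝ ∞ (fun y => (ContinuousLinearMap.compL ℝ E E' ℝ).flip (Q y)) a :=
    hQ.continuousLinearMap_comp _
  exact h1.clm_comp (hG.clm_comp hP)

/-- An endomorphism field is smooth when the bilinear forms `G(Φ ·, ·)` are. -/
theorem IsMetricNear.contDiffAt_endo [FiniteDimensional ℝ E] {G : E → E →L[ℝ] E →L[ℝ] ℝ} {a : E}
    (hG : IsMetricNear G a) {Φ : E → E →L[ℝ] E} {B : E → E →L[ℝ] E →L[ℝ] ℝ}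
    (hB : ContDiffAt ℝ ∞ B a) (hΦ : ∀ᶠ y in 𝓝 a, ∀ w z, G y (Φ y w) z = B y w z) :
    ContDiffAt ℝ ∞ Φ a := by
  have h4 : ContDiffAt ℝ ∞ (fun y => sharp (G y)) a :=
    (hG.invertible.self_of_nhds.contDiffAt_map_inverse).comp a hG.smooth.self_of_nhds
  refine (h4.clm_comp hB).congr_of_eventuallyEq ?_
  filter_upwards [hΦ, hG.eventually] with y hy hGy
  ext w
  refine hGy.ext fun z => ?_
  rw [hy, ContinuousLinearMap.comp_apply, apply_sharp hGy.invertible.self_of_nhds]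

/-- The function `g'(n, J n)`, equal to `tan t`. -/
def normalSlope (G' : E' → E' →L[ℝ] E' →L[ℝ] ℝ) (J' : E' → E' →L[ℝ] E') (h n : E → E') (y : E) :
    ℝ :=
  G' (h y) (n y) (J' (h y) (n y))

/-- The form `g'(dh ·, J n)`. -/
def normalForm (G' : E' → E' →L[ℝ] E' →L[ℝ] ℝ) (J' : E' → E' →L[ℝ] E') (h n : E → E') (y v : E) :
    ℝ :=
  G' (h y) (fderiv ℝ h y v) (J' (h y) (n y))

variable {G : E → E →L[ℝ] E →L[ℝ] ℝ} {G' : E' → E' →L[ℝ] E' →L[ℝ] ℝ} {h n : E → E'} {a : E}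

theorem IsHypersurfaceNear.contDiffAt_normalSlope (hh : IsHypersurfaceNear G G' h n a)
    {J' : E' → E' →L[ℝ] E'} (hJ : ContDiffAt ℝ ∞ J' (h a)) :
    ContDiffAt ℝ ∞ (normalSlope G' J' h n) a := by
  have hs := hh.smooth.self_of_nhds
  have hn := hh.smooth_normal.self_of_nhds
  exact ((hh.metric'.smooth.self_of_nhds.comp a hs).clm_apply hn).clm_apply
    ((hJ.comp a hs).clm_apply hn)

/-- The pulled back form `g'(J dh ·, dh ·)`, corrected by a multiple of the square of
`normalForm`, is smooth; it is the form `g(φ ·, ·)` of the induced structure. -/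
theorem IsHypersurfaceNear.contDiffAt_induced [FiniteDimensional ℝ E]
    (hh : IsHypersurfaceNear G G' h n a) {J' : E' → E' →L[ℝ] E'} (hJ : ContDiffAt ℝ ∞ J' (h a))
    {Φ : E → E →L[ℝ] E}
    (hΦ : ∀ᶠ y in 𝓝 a, ∀ w z, G y (Φ y w) z =
      G' (h y) (J' (h y) (fderiv ℝ h y w)) (fderiv ℝ h y z)
        - normalSlope G' J' h n y / (1 + normalSlope G' J' h n y ^ 2)
          * normalForm G' J' h n y w * normalForm G' J' h n y z) :
    ContDiffAt ℝ ∞ Φ a := by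
  have hs := hh.smooth.self_of_nhds
  have hn := hh.smooth_normal.self_of_nhds
  have hG' : ContDiffAt ℝ ∞ (fun y => G' (h y)) a := hh.metric'.smooth.self_of_nhds.comp a hs
  have hJ' : ContDiffAt ℝ ∞ (fun y => J' (h y)) a := hJ.comp a hs
  have hJn : ContDiffAt ℝ ∞ (fun y => J' (h y) (n y)) a := hJ'.clm_apply hn
  have hslope := hh.contDiffAt_normalSlope hJ
  have hcoef : ContDiffAt ℝ ∞
      (fun y => normalSlope G' J' h n y / (1 + normalSlope G' J' h n y ^ 2)) a :=
    hslope.div (contDiffAt_const.add (hslope.pow 2)) (by positivity)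
  have hG'f : ContDiffAt ℝ ∞ (fun y => (G' (h y)).flip) a :=
    hG'.continuousLinearMap_comp
      (ContinuousLinearMap.flipₗᵢ ℝ E' E' ℝ).toContinuousLinearEquiv.toContinuousLinearMap
  have hβ : ContDiffAt ℝ ∞ (fun y => ((G' (h y)).flip (J' (h y) (n y))).comp (fderiv ℝ h y)) a :=
    (hG'f.clm_apply hJn).clm_comp hs.fderiv_infty
  have hββ : ContDiffAt ℝ ∞ (fun y => ContinuousLinearMap.smulRightL ℝ E (E →L[ℝ] ℝ)
      (((G' (h y)).flip (J' (h y) (n y))).comp (fderiv ℝ h y))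
      (((G' (h y)).flip (J' (h y) (n y))).comp (fderiv ℝ h y))) a :=
    (hβ.continuousLinearMap_comp (ContinuousLinearMap.smulRightL ℝ E (E →L[ℝ] ℝ))).clm_apply hβ
  have hB := (hG'.bilinearComp (hJ'.clm_comp hs.fderiv_infty) hs.fderiv_infty).sub
    (hcoef.smul hββ)
  refine hh.metric.contDiffAt_endo hB ?_
  filter_upwards [hΦ] with y hy w z
  rw [hy]
  simp [normalForm]
  ring

variable {J' : E' → E' →L[ℝ] E'}

/-- The derivative of `tan t` is `-2 g'(dh (A ·), J n)`. -/
theorem IsHypersurfaceNear.hasLineDerivAt_normalSlope (hh : IsHypersurfaceNear G G' h n a)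
    (hJ : ContDiffAt ℝ ∞ J' (h a)) (hpar : ∀ v w, coordCovDeriv G' J' (h a) v w = 0)
    (hsa : ∀ x y, G' (h a) (J' (h a) x) y = G' (h a) x (J' (h a) y)) {v v' : E}
    (hA : normalDeriv G' h n a v = -fderiv ℝ h a v') :
    HasLineDerivAt ℝ (normalSlope G' J' h n) (-2 * normalForm G' J' h n a v') a v := by
  have hs := hh.smooth.self_of_nhds
  have h1 : HasLineDerivAt ℝ (normalSlope G' J' h n) _ a v :=
    (hh.hasCovDerivAt_normal v).metric hh.metric' hs
      ((hh.hasCovDerivAt_normal v).parallel hJ hpar hs)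
  have hsym := hh.metric'.symm.self_of_nhds
  convert h1 using 1
  rw [hA, hsym (n a), hsa]
  simp [normalForm]
  ring

/-- The tensor `g((∇ Φ) ·, ·)` of the induced structure in terms of the shape operator. Here `v'`
stands for `A v`. -/
theorem IsHypersurfaceNear.coordCovDeriv_induced [FiniteDimensional ℝ E]
    (hh : IsHypersurfaceNear G G' h n a)
    (hJ : ContDiffAt ℝ ∞ J' (h a)) (hpar : ∀ v w, coordCovDeriv G' J' (h a) v w = 0)
    (hsa : ∀ x y, G' (h a) (J' (h a) x) y = G' (h a) x (J' (h a) y)) {v v' : E}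
    (hA : normalDeriv G' h n a v = -fderiv ℝ h a v') {Φ : E → E →L[ℝ] E}
    (hΦ : ∀ᶠ y in 𝓝 a, ∀ w z, G y (Φ y w) z =
      G' (h y) (J' (h y) (fderiv ℝ h y w)) (fderiv ℝ h y z)
        - normalSlope G' J' h n y / (1 + normalSlope G' J' h n y ^ 2)
          * normalForm G' J' h n y w * normalForm G' J' h n y z)
    {s : ℝ} (hslope : s = normalSlope G' J' h n a) {β : E → ℝ} (hβ : β = normalForm G' J' h n a)
    (w z : E) :
    G a (coordCovDeriv G Φ a v w) z =
      (-(1 / (1 + s ^ 2)) * G a v' w + s / (1 + s ^ 2) * G a (Φ a v') w) * β z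
      + (-(1 / (1 + s ^ 2)) * G a v' z + s / (1 + s ^ 2) * G a (Φ a v') z) * β w
      + 2 / (1 + s ^ 2) ^ 2 * β v' * β w * β z := by
  have hs := hh.smooth.self_of_nhds
  have hsym := hh.metric'.symm.self_of_nhds
  have hpos : (1 + s ^ 2) ≠ 0 := by positivity
  have cn := (hh.hasCovDerivAt_normal v)
  have cJn := cn.parallel hJ hpar hs
  have dslope := hh.hasLineDerivAt_normalSlope hJ hpar hsa hA
  have hII : ∀ w, secondForm G' h n a v w = -G a v' w := by
    intro w
    rw [← hh.normalDeriv_tangential, hA, hh.pullback.self_of_nhds]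
    simp
  have hΦa := hΦ.self_of_nhds
  rw [← hslope, ← hβ] at hΦa
  rw [← hβ] at dslope
  have dcoef : HasLineDerivAt ℝ
      (fun y => normalSlope G' J' h n y / (1 + normalSlope G' J' h n y ^ 2))
      (-2 * β v' * (1 - s ^ 2) / (1 + s ^ 2) ^ 2) a v := by
    have h1 := HasDerivAt.fun_div dslope ((HasDerivAt.fun_pow dslope 2).const_add 1)
      (by positivity)
    refine HasDerivAt.congr_deriv h1 ?_
    simp only [zero_smul, add_zero, ← hslope]
    congr 1
    norm_num
    ring
  have dβ : ∀ w, HasLineDerivAt ℝ (fun y => normalForm G' J' h n y w)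
      (β (christoffelL G a v w) - G a v' w * s - (G a (Φ a v') w + s / (1 + s ^ 2) * β v' * β w))
      a v := by
    intro w
    have h1 : HasLineDerivAt ℝ (fun y => normalForm G' J' h n y w) _ a v :=
      (hh.hasCovDerivAt_fderiv v w).metric hh.metric' hs cJn
    convert h1 using 1
    rw [hh.accel_eq, hII, hA, hΦa, hslope, hβ]
    simp only [normalForm, normalSlope, map_add, map_neg, map_smul, add_apply, smul_apply,
      smul_eq_mul, hsym (fderiv ℝ h a w) (J' (h a) (fderiv ℝ h a v'))]
    ring
  have dJ : HasLineDerivAt ℝ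
      (fun y => G' (h y) (J' (h y) (fderiv ℝ h y w)) (fderiv ℝ h y z)) _ a v :=
    ((hh.hasCovDerivAt_fderiv v w).parallel hJ hpar hs).metric hh.metric' hs
      (hh.hasCovDerivAt_fderiv v z)
  have dB := dJ.sub ((dcoef.mul (dβ w)).mul (dβ z))
  have dΦ := ((hh.contDiffAt_induced hJ hΦ).hasLineDerivAt v).clm_apply (hasLineDerivAt_const w)
  have dG := ((hh.metric.smooth.self_of_nhds.hasLineDerivAt v).clm_apply dΦ).clm_apply
    (hasLineDerivAt_const z)
  have key := dG.unique (dB.congr_of_eventuallyEq (by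
    filter_upwards [hΦ] with y hy using hy w z))
  have hJn : ∀ u, G' (h a) (J' (h a) (n a)) (fderiv ℝ h a u) = β u := fun u => by
    rw [hsym, hβ, normalForm]
  have hJn' : ∀ u, G' (h a) (J' (h a) (fderiv ℝ h a u)) (n a) = β u := fun u => by
    rw [hsa, hβ, normalForm]
  have hJJ : ∀ u v, G' (h a) (J' (h a) (fderiv ℝ h a u)) (fderiv ℝ h a v) =
      G a (Φ a u) v + s / (1 + s ^ 2) * β u * β v := fun u v => by rw [hΦa]; ring
  rw [hh.accel_eq, hh.accel_eq, ← hslope, ← hβ] at key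
  simp only [map_add, map_smul, add_apply, smul_apply, smul_eq_mul, map_zero, add_zero,
    hh.metric.fderiv_apply, hJn, hJn', hJJ, hII] at key
  simp only [coordCovDeriv, ← christoffelL_apply, map_add, map_sub, add_apply, sub_apply]
  field_simp at key ⊢
  linear_combination key

end InducedStructure

/-! ### Charts -/

section Charts

variable {E : Type*} [NormedAddCommGroup E] [NormedSpace ℝ E]
  {M : Type*} [TopologicalSpace M] [ChartedSpace E M] [IsManifold 𝓘(ℝ, E) ∞ M]

/-- The coordinate frame of the chart at `p`, with the tangent spaces, which depend on `y`, read
as the model space `E`. -/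
def frameE (p : M) (y : E) : E →L[ℝ] E := frame p y

/-- The derivative of the chart at `p`, at the point with coordinates `y`. -/
def coframeE (p : M) (y : E) : E →L[ℝ] E :=
  mfderiv 𝓘(ℝ, E) 𝓘(ℝ, E) (extChartAt 𝓘(ℝ, E) p) ((extChartAt 𝓘(ℝ, E) p).symm y)

theorem frameE_coframeE {p : M} {y : E} (hy : y ∈ (extChartAt 𝓘(ℝ, E) p).target) (v : E) :
    frameE p y (coframeE p y v) = v := by
  have : IsManifold 𝓘(ℝ, E) 1 M := IsManifold.of_le (n := ∞) (by simp)
  have h := mfderivWithin_extChartAt_symm_comp_mfderiv_extChartAt (I := 𝓘(ℝ, E)) hy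
  simp only [ModelWithCorners.range_eq_univ, mfderivWithin_univ] at h
  exact congrArg (fun L => L v) h

theorem coframeE_frameE {p : M} {y : E} (hy : y ∈ (extChartAt 𝓘(ℝ, E) p).target) (v : E) :
    coframeE p y (frameE p y v) = v := by
  have : IsManifold 𝓘(ℝ, E) 1 M := IsManifold.of_le (n := ∞) (by simp)
  have h := mfderiv_extChartAt_comp_mfderivWithin_extChartAt_symm (I := 𝓘(ℝ, E)) hy
  simp only [ModelWithCorners.range_eq_univ, mfderivWithin_univ] at h
  exact congrArg (fun L => L v) h

theorem frameE_self (p : M) (v : E) : frameE p (extChartAt 𝓘(ℝ, E) p p) v = v := by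
  have : IsManifold 𝓘(ℝ, E) 1 M := IsManifold.of_le (n := ∞) (by simp)
  have h := mfderivWithin_range_extChartAt_symm (I := 𝓘(ℝ, E)) (x := p)
  simp only [ModelWithCorners.range_eq_univ, mfderivWithin_univ] at h
  exact congrArg (fun L => L v) h

omit [IsManifold 𝓘(ℝ, E) ∞ M] in
theorem eventually_mem_target (p : M) :
    ∀ᶠ y in 𝓝 (extChartAt 𝓘(ℝ, E) p p), y ∈ (extChartAt 𝓘(ℝ, E) p).target :=
  (isOpen_extChartAt_target p).mem_nhds (mem_extChartAt_target p)

variable {E' : Type*} [NormedAddCommGroup E'] [NormedSpace ℝ E']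
  {M' : Type*} [TopologicalSpace M'] [ChartedSpace E' M'] [IsManifold 𝓘(ℝ, E') ∞ M']

/-- The map `f` in the charts at `p` and `q`. -/
def inCharts (f : M → M') (p : M) (q : M') (y : E) : E' :=
  extChartAt 𝓘(ℝ, E') q (f ((extChartAt 𝓘(ℝ, E) p).symm y))

/-- The differential of `f` at the point with coordinates `y`. -/
def mfderivE (f : M → M') (p : M) (y : E) : E →L[ℝ] E' :=
  mfderiv 𝓘(ℝ, E) 𝓘(ℝ, E') f ((extChartAt 𝓘(ℝ, E) p).symm y)

variable {f : M → M'} (hf : ContMDiff 𝓘(ℝ, E) 𝓘(ℝ, E') ∞ f) {p : M} {q : M'} {y : E}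
  (hy : y ∈ (extChartAt 𝓘(ℝ, E) p).target)
  (hfy : f ((extChartAt 𝓘(ℝ, E) p).symm y) ∈ (extChartAt 𝓘(ℝ, E') q).source)

include hf hy hfy

theorem contDiffAt_inCharts : ContDiffAt ℝ ∞ (inCharts f p q : E → E') y := by
  rw [← contMDiffAt_iff_contDiffAt]
  have h1 : ContMDiffAt 𝓘(ℝ, E) 𝓘(ℝ, E) ∞ (extChartAt 𝓘(ℝ, E) p).symm y :=
    (contMDiffOn_extChartAt_symm p).contMDiffAt ((isOpen_extChartAt_target p).mem_nhds hy)
  have h2 : ContMDiffAt 𝓘(ℝ, E') 𝓘(ℝ, E') ∞ (extChartAt 𝓘(ℝ, E') q)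
      (f ((extChartAt 𝓘(ℝ, E) p).symm y)) :=
    contMDiffAt_extChartAt' (by simpa using hfy)
  exact h2.comp y ((hf _).comp y h1)

omit [IsManifold 𝓘(ℝ, E) ∞ M] [IsManifold 𝓘(ℝ, E') ∞ M'] in
theorem eventually_mem_source : ∀ᶠ z in 𝓝 y,
    f ((extChartAt 𝓘(ℝ, E) p).symm z) ∈ (extChartAt 𝓘(ℝ, E') q).source := by
  have h1 : ContinuousAt (extChartAt 𝓘(ℝ, E) p).symm y := continuousAt_extChartAt_symm'' hy
  exact (hf.continuous.continuousAt.comp h1).eventually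
    ((isOpen_extChartAt_source q).mem_nhds hfy)

/-- The coordinate expression of the differential. -/
theorem frameE_fderiv_inCharts (v : E) :
    frameE q (inCharts f p q y : E') (fderiv ℝ (inCharts f p q : E → E') y v) =
      mfderivE f p y (frameE p y v) := by
  have hM : IsManifold 𝓘(ℝ, E) 1 M := IsManifold.of_le (n := ∞) (by simp)
  have hM' : IsManifold 𝓘(ℝ, E') 1 M' := IsManifold.of_le (n := ∞) (by simp)
  have hq : (inCharts f p q y : E') ∈ (extChartAt 𝓘(ℝ, E') q).target :=
    (extChartAt 𝓘(ℝ, E') q).map_source hfy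
  have h1 : MDifferentiableAt 𝓘(ℝ, E) 𝓘(ℝ, E) (extChartAt 𝓘(ℝ, E) p).symm y := by
    have := mdifferentiableWithinAt_extChartAt_symm (I := 𝓘(ℝ, E)) hy
    rwa [ModelWithCorners.range_eq_univ, mdifferentiableWithinAt_univ] at this
  have h2 : MDifferentiableAt 𝓘(ℝ, E') 𝓘(ℝ, E') (extChartAt 𝓘(ℝ, E') q).symm
      (inCharts f p q y : E') := by
    have := mdifferentiableWithinAt_extChartAt_symm (I := 𝓘(ℝ, E')) hq
    rwa [ModelWithCorners.range_eq_univ, mdifferentiableWithinAt_univ] at this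
  have h3 : MDifferentiableAt 𝓘(ℝ, E) 𝓘(ℝ, E') (inCharts f p q : E → E') y :=
    ((contDiffAt_inCharts hf hy hfy).differentiableAt (by simp)).mdifferentiableAt
  have h4 : MDifferentiableAt 𝓘(ℝ, E) 𝓘(ℝ, E') f ((extChartAt 𝓘(ℝ, E) p).symm y) :=
    (hf _).mdifferentiableAt (by simp)
  have h5 := mfderiv_comp y h2 h3
  have h6 := mfderiv_comp y h4 h1
  have h7 : (extChartAt 𝓘(ℝ, E') q).symm ∘ (inCharts f p q : E → E') =ᶠ[𝓝 y]
      f ∘ (extChartAt 𝓘(ℝ, E) p).symm := by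
    filter_upwards [eventually_mem_source hf hy hfy] with z hz
    exact (extChartAt 𝓘(ℝ, E') q).left_inv hz
  have h8 := h7.mfderiv_eq (I := 𝓘(ℝ, E)) (I' := 𝓘(ℝ, E'))
  rw [h6] at h8
  have h9 := h5.symm.trans h8
  rw [mfderiv_eq_fderiv] at h9
  exact congrArg (fun L : E →L[ℝ] E' => L v) h9

end Charts

/-! ### Kähler-Norden manifolds in charts -/

section Kahler

variable {E : Type*} [NormedAddCommGroup E] [NormedSpace ℝ E]
  {M : Type*} [TopologicalSpace M] [ChartedSpace E M]

namespace KahlerNorden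

variable (K : KahlerNorden E M)

/-- The metric at `q`, as a bilinear form on the model space. -/
def gE (q : M) : E →L[ℝ] E →L[ℝ] ℝ := K.g q

/-- The complex structure at `q`, as an endomorphism of the model space. -/
def jE (q : M) : E →L[ℝ] E := K.J q

theorem bilinInChart_apply (p : M) (y v w : E) : bilinInChart K.g p y v w =
    K.gE ((extChartAt 𝓘(ℝ, E) p).symm y) (frameE p y v) (frameE p y w) := rfl

theorem gE_symm (q : M) (v w : E) : K.gE q v w = K.gE q w v := K.symm q v w

theorem gE_nondeg (q : M) (v : E) (h : ∀ w, K.gE q v w = 0) : v = 0 := K.nondegenerate q v h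

theorem jE_sq (q : M) (v : E) : K.jE q (K.jE q v) = -v := K.J_sq q v

theorem gE_jE (q : M) (v w : E) : K.gE q (K.jE q v) (K.jE q w) = -K.gE q v w := K.norden q v w

theorem isNorden (q : M) : IsNorden
    ((ContinuousLinearMap.coeLM ℝ).comp (K.gE q).toLinearMap) (K.jE q).toLinearMap where
  symm := K.gE_symm q
  nondeg := K.gE_nondeg q
  sq := K.jE_sq q
  anti := K.gE_jE q

theorem jE_self_adjoint (q : M) (v w : E) : K.gE q (K.jE q v) w = K.gE q v (K.jE q w) :=
  (K.isNorden q).self_adjoint v w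

variable [IsManifold 𝓘(ℝ, E) ∞ M] {K} {p : M} {y : E}
  (hy : y ∈ (extChartAt 𝓘(ℝ, E) p).target)

include hy

theorem frameE_endoInChart (w : E) : frameE p y (endoInChart K.J p y w) =
    K.jE ((extChartAt 𝓘(ℝ, E) p).symm y) (frameE p y w) :=
  frameE_coframeE hy _

theorem isMetricNear [FiniteDimensional ℝ E] : IsMetricNear (bilinInChart K.g p) y where
  smooth := by
    filter_upwards [(isOpen_extChartAt_target p).mem_nhds hy] with z hz
    exact (K.smooth_g p).contDiffAt ((isOpen_extChartAt_target p).mem_nhds hz)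
  symm := Eventually.of_forall fun z v w => by
    rw [bilinInChart_apply, bilinInChart_apply, gE_symm]
  invertible := by
    filter_upwards [(isOpen_extChartAt_target p).mem_nhds hy] with z hz
    refine isInvertible_of_nondegenerate fun v hv => ?_
    have h1 : frameE p z v = 0 := by
      refine K.gE_nondeg ((extChartAt 𝓘(ℝ, E) p).symm z) _ fun w => ?_
      rw [← frameE_coframeE hz w, ← bilinInChart_apply, hv]
    rw [← coframeE_frameE hz v, h1, map_zero]

omit [IsManifold 𝓘(ℝ, E) ∞ M] in
theorem contDiffAt_endoInChart : ContDiffAt ℝ ∞ (endoInChart K.J p) y :=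
  (K.smooth_J p).contDiffAt ((isOpen_extChartAt_target p).mem_nhds hy)

/-- The complex structure is parallel at all points of a chart, not only at its centre. -/
theorem coordCovDeriv_eq_zero [FiniteDimensional ℝ E] (v w : E) :
    coordCovDeriv (bilinInChart K.g p) (endoInChart K.J p) y v w = 0 := by
  set q : M := (extChartAt 𝓘(ℝ, E) p).symm y with hq
  set c : E := extChartAt 𝓘(ℝ, E) q q with hc
  have hcq : (extChartAt 𝓘(ℝ, E) q).symm c = q := extChartAt_to_inv q
  have hct : c ∈ (extChartAt 𝓘(ℝ, E) q).target := mem_extChartAt_target q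
  set τ : E → E := inCharts (id : M → M) q p with hτ
  have hid : ContMDiff 𝓘(ℝ, E) 𝓘(ℝ, E) ∞ (id : M → M) := contMDiff_id
  have hqs : (id : M → M) ((extChartAt 𝓘(ℝ, E) q).symm c) ∈ (extChartAt 𝓘(ℝ, E) p).source := by
    rw [hcq]; exact (extChartAt 𝓘(ℝ, E) p).map_target hy
  have hτc : τ c = y := by
    simp only [hτ, inCharts, hcq, id_eq]
    exact (extChartAt 𝓘(ℝ, E) p).right_inv hy
  have hev : ∀ᶠ z in 𝓝 c, z ∈ (extChartAt 𝓘(ℝ, E) q).target ∧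
      (id : M → M) ((extChartAt 𝓘(ℝ, E) q).symm z) ∈ (extChartAt 𝓘(ℝ, E) p).source :=
    Filter.Eventually.and ((isOpen_extChartAt_target q).mem_nhds hct)
      (eventually_mem_source hid hct hqs)
  have hframe : ∀ z, z ∈ (extChartAt 𝓘(ℝ, E) q).target →
      (id : M → M) ((extChartAt 𝓘(ℝ, E) q).symm z) ∈ (extChartAt 𝓘(ℝ, E) p).source → ∀ v,
      frameE p (τ z) (fderiv ℝ τ z v) = frameE q z v := by
    intro z hz hz' v
    rw [hτ, frameE_fderiv_inCharts hid hz hz', mfderivE, mfderiv_id]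
    rfl
  have hbase : ∀ z, (id : M → M) ((extChartAt 𝓘(ℝ, E) q).symm z) ∈ (extChartAt 𝓘(ℝ, E) p).source →
      (extChartAt 𝓘(ℝ, E) p).symm (τ z) = (extChartAt 𝓘(ℝ, E) q).symm z := fun z hz =>
    (extChartAt 𝓘(ℝ, E) p).left_inv hz
  have hiso : IsIsometryNear (bilinInChart K.g q) (bilinInChart K.g p) τ c :=
    { metric := isMetricNear hct
      metric' := by rw [hτc]; exact isMetricNear hy
      smooth := by
        filter_upwards [hev] with z hz using contDiffAt_inCharts hid hz.1 hz.2
      pullback := by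
        filter_upwards [hev] with z hz v w
        rw [bilinInChart_apply, bilinInChart_apply, hframe z hz.1 hz.2, hframe z hz.1 hz.2,
          hbase z hz.2] }
  have hsurj : Function.Surjective (fderiv ℝ τ c) := by
    intro u
    refine ⟨frameE p y u, ?_⟩
    have h1 := hframe c hct hqs (frameE p y u)
    rw [frameE_self, hτc] at h1
    rw [← coframeE_frameE hy (fderiv ℝ τ c _), h1, coframeE_frameE hy]
  have key := fun v w => hiso.coordCovDeriv_eq hsurj (J := endoInChart K.J q)
    (J' := endoInChart K.J p) (contDiffAt_endoInChart hct)
    (by rw [hτc]; exact contDiffAt_endoInChart hy) (by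
      filter_upwards [hev] with z hz w
      have hz' : τ z ∈ (extChartAt 𝓘(ℝ, E) p).target := (extChartAt 𝓘(ℝ, E) p).map_source hz.2
      rw [← coframeE_frameE hz' (fderiv ℝ τ z _), hframe z hz.1 hz.2, frameE_endoInChart hz.1,
        ← coframeE_frameE hz' (endoInChart K.J p (τ z) _), frameE_endoInChart hz',
        hframe z hz.1 hz.2, hbase z hz.2]) v w
  obtain ⟨v, rfl⟩ := hsurj v
  obtain ⟨w, rfl⟩ := hsurj w
  rw [← hτc, ← key v w]
  have hpar : coordCovDeriv (bilinInChart K.g q) (endoInChart K.J q) c v w = 0 := K.parallel q v w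
  rw [hpar, map_zero]

omit hy in
theorem bilinInChart_self (q : M) : bilinInChart K.g q (extChartAt 𝓘(ℝ, E) q q) = K.gE q := by
  ext v w
  rw [bilinInChart_apply, frameE_self, frameE_self, extChartAt_to_inv]

omit hy in
theorem endoInChart_self (q : M) : endoInChart K.J q (extChartAt 𝓘(ℝ, E) q q) = K.jE q := by
  ext w
  rw [← frameE_self q (endoInChart K.J q _ w), frameE_endoInChart (mem_extChartAt_target q),
    frameE_self, extChartAt_to_inv]

omit hy in
/-- The curvature tensor of a Kähler-Norden manifold of constant totally real sectional
curvatures. -/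
theorem curvature4_eq [FiniteDimensional ℝ E] (hdim : 2 < Module.finrank ℝ E) {ν νt : M → ℝ}
    (hK : K.HasConstantTotallyRealCurvatures ν νt) (q : M) (x y z u : E) :
    K.gE q (coordCurvature (bilinInChart K.g q) (extChartAt 𝓘(ℝ, E) q q) x y z) u =
      ν q * (pi1 (K.gE q) x y z u - pi2 (K.gE q) (K.jE q) x y z u)
        + νt q * pi3 (K.gE q) (K.jE q) x y z u := by
  have hct := mem_extChartAt_target (I := 𝓘(ℝ, E)) q
  set c := extChartAt 𝓘(ℝ, E) q q with hc
  set R : E → E → E → E → ℝ := fun x y z u =>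
    K.gE q (coordCurvature (bilinInChart K.g q) c x y z) u with hR
  have hRc : IsCurvatureLike R := by
    have := (isMetricNear (K := K) hct).isCurvatureLike
    rwa [bilinInChart_self] at this
  have hRJ : ∀ x y z u, R x y (K.jE q z) u = R x y z (K.jE q u) := by
    intro x y z u
    have h1 := (isMetricNear (K := K) hct).coordCurvature_parallel (J := endoInChart K.J q)
      (by filter_upwards [eventually_mem_target q] with z hz using contDiffAt_endoInChart hz)
      (by filter_upwards [eventually_mem_target q] with z hz using coordCovDeriv_eq_zero hz) x y z
    rw [endoInChart_self] at h1
    simp only [hR]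
    rw [h1, jE_self_adjoint]
  have hg := K.gE_symm q
  have hj := K.jE_self_adjoint q
  have hjj := K.jE_sq q
  have hgj : ∀ x y, K.gE q x (K.jE q y) = K.gE q y (K.jE q x) := fun x y => by rw [← hj, hg]
  have hT : IsKahlerTensor (K.jE q).toLinearMap fun x y z u => R x y z u -
      (ν q * (pi1 (K.gE q) x y z u - pi2 (K.gE q) (K.jE q) x y z u)
        + νt q * pi3 (K.gE q) (K.jE q) x y z u) :=
    { add := fun x x' y z u => by
        simp only [hRc.add, pi1, pi2, pi3, map_add, add_apply]; ring
      smul := fun c x y z u => by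
        simp only [hRc.smul, pi1, pi2, pi3, map_smul, smul_apply, smul_eq_mul]; ring
      skew := fun x y z u => by
        rw [hRc.skew x y]; simp only [pi1, pi2, pi3]; ring
      skew' := fun x y z u => by
        rw [hRc.skew' x y]; simp only [pi1, pi2, pi3]; ring
      bianchi := fun x y z u => by
        have := hRc.bianchi x y z u
        simp only [pi1, pi2, pi3, hg y x, hg z x, hg z y, hgj y x, hgj z x, hgj z y]
        linear_combination this
      kahler := fun x y z u => by
        simp only [ContinuousLinearMap.coe_coe, hRJ, pi1, pi2, pi3, hjj, map_neg]
        ring }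
  have key := hT.eq_zero (K.isNorden q) hdim (fun x y hx hy hxy hxx hxy' hyy => ?_) x y z u
  · linear_combination key
  · replace hx : K.gE q x x = 1 := hx
    replace hy : K.gE q y y = 1 := hy
    replace hxy : K.gE q x y = 0 := hxy
    replace hxx : K.gE q x (K.jE q x) = 0 := hxx
    replace hyy : K.gE q y (K.jE q y) = 0 := hyy
    replace hxy' : K.gE q x (K.jE q y) = 0 := hxy'
    have hyx : K.gE q y x = 0 := by rw [hg, hxy]
    have hyx' : K.gE q y (K.jE q x) = 0 := by rw [← hj, hg, hxy']
    have hpi : pi1 (K.gE q) x y y x = 1 := by simp [pi1, hx, hy, hxy]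
    have h1 := hK q x y (by
      change pi1 (K.gE q) x y y x ≠ 0
      rw [hpi]; norm_num) (by
      change K.gE q (K.jE q x) x = 0 ∧ K.gE q (K.jE q x) y = 0 ∧ K.gE q (K.jE q y) x = 0 ∧
        K.gE q (K.jE q y) y = 0
      simp only [hj, hxx, hxy', hyx', hyy, and_self])
    have h2 : R x y y x / pi1 (K.gE q) x y y x = ν q := h1.1
    have h3 : R x y y (K.jE q x) / pi1 (K.gE q) x y y x = νt q := h1.2
    rw [hpi, div_one] at h2 h3
    constructor
    · simp [h2, pi1, pi2, pi3, hx, hy, hxy, hxx, hyy, hxy', hyx, hyx']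
    · simp [h3, pi1, pi2, pi3, hx, hy, hxy, hxx, hyy, hxy', hyx, hyx', hjj]

end KahlerNorden

end Kahler

/-! ### Hyperplanes with a unit normal -/

section Hyperplane

variable {E E' : Type*} [NormedAddCommGroup E] [NormedSpace ℝ E]
  [NormedAddCommGroup E'] [NormedSpace ℝ E'] [FiniteDimensional ℝ E']

/-- In codimension one every vector orthogonal to the normal is tangent. -/
theorem exists_tangent {G : E' →L[ℝ] E' →L[ℝ] ℝ} {L : E →L[ℝ] E'} {N : E'}
    (hL : Function.Injective L) (hn : ∀ x, G (L x) N = 0) (hN : G N N = -1)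
    (hdim : Module.finrank ℝ E' = Module.finrank ℝ E + 1) {w : E'} (hw : G w N = 0) :
    ∃ x, L x = w := by
  have hle : LinearMap.range L.toLinearMap ≤ LinearMap.ker (G.flip N).toLinearMap := by
    rintro _ ⟨x, rfl⟩
    exact hn x
  have h1 : Module.finrank ℝ (LinearMap.range L.toLinearMap) = Module.finrank ℝ E :=
    LinearMap.finrank_range_of_inj hL
  have h2 := (G.flip N).toLinearMap.finrank_range_add_finrank_ker
  have h3 : 0 < Module.finrank ℝ (LinearMap.range (G.flip N).toLinearMap) := by
    have h4 : LinearMap.range (G.flip N).toLinearMap ≠ ⊥ := by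
      intro h0
      have h5 : G N N ∈ LinearMap.range (G.flip N).toLinearMap := ⟨N, rfl⟩
      rw [h0, Submodule.mem_bot, hN] at h5
      norm_num at h5
    have := Submodule.nontrivial_iff_ne_bot.2 h4
    exact Module.finrank_pos
  have heq := Submodule.eq_of_le_of_finrank_le hle (by omega)
  have hmem : w ∈ LinearMap.ker (G.flip N).toLinearMap := hw
  rw [← heq] at hmem
  exact hmem

/-- The tangent hyperplane and the normal span the ambient space. -/
theorem eq_zero_of_orthogonal {G : E' →L[ℝ] E' →L[ℝ] ℝ} (hG : ∀ v, (∀ w, G v w = 0) → v = 0)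
    {L : E →L[ℝ] E'} {N : E'}
    (hL : Function.Injective L) (hn : ∀ x, G (L x) N = 0) (hN : G N N = -1)
    (hdim : Module.finrank ℝ E' = Module.finrank ℝ E + 1) {X : E'} (h1 : ∀ u, G X (L u) = 0)
    (h2 : G X N = 0) : X = 0 := by
  refine hG X fun w => ?_
  obtain ⟨x, hx⟩ := exists_tangent hL hn hN hdim (w := w + G w N • N) (by simp [hN])
  have h3 : w = L x - G w N • N := by rw [hx]; abel
  rw [h3, map_sub, map_smul, h1, h2]
  simp

end Hyperplane

namespace TimelikeHypersurface

variable {E' : Type*} [NormedAddCommGroup E'] [NormedSpace ℝ E'] [FiniteDimensional ℝ E']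
  {M' : Type*} [TopologicalSpace M'] [ChartedSpace E' M'] [IsManifold 𝓘(ℝ, E') ∞ M']
  {K : KahlerNorden E' M'}
  {E : Type*} [NormedAddCommGroup E] [NormedSpace ℝ E] [FiniteDimensional ℝ E]
  {M : Type*} [TopologicalSpace M] [ChartedSpace E M]
  (S : TimelikeHypersurface K E M)

/-! ### The induced almost contact structure -/

/-- The induced metric at `q`, on the model space. -/
def gE (q : M) : E →L[ℝ] E →L[ℝ] ℝ := S.g q

/-- The differential of the immersion at `q`, between the model spaces. -/
def dfE (q : M) : E →L[ℝ] E' := S.df q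

/-- The normal at `q`, in the model space. -/
def nE (q : M) : E' := S.N q

/-- The tangential projection at `q`, between the model spaces. -/
def tanE (q : M) : E' →L[ℝ] E := S.tangential q

/-- The endomorphism `φ` at `q`, on the model space. -/
def phiE (q : M) : E →L[ℝ] E := S.φ q

/-- The form `η` at `q`, on the model space. -/
def etaE (q : M) : E →L[ℝ] ℝ := S.η q

/-- The vector `ξ` at `q`, in the model space. -/
def xiE (q : M) : E := S.ξ q

omit [FiniteDimensional ℝ E] [FiniteDimensional ℝ E'] in
theorem gE_apply (q : M) (v w : E) : S.gE q v w = K.gE (S.f q) (S.dfE q v) (S.dfE q w) := rfl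

omit [FiniteDimensional ℝ E] [FiniteDimensional ℝ E'] in
theorem gE_symm (q : M) (v w : E) : S.gE q v w = S.gE q w v := by
  rw [gE_apply, K.gE_symm, gE_apply]

omit [FiniteDimensional ℝ E] [FiniteDimensional ℝ E'] in
theorem gE_nE (q : M) (v : E) : K.gE (S.f q) (S.dfE q v) (S.nE q) = 0 := S.normal q v

omit [FiniteDimensional ℝ E] [FiniteDimensional ℝ E'] in
theorem nE_nE (q : M) : K.gE (S.f q) (S.nE q) (S.nE q) = -1 := S.timelike q

omit [FiniteDimensional ℝ E] [FiniteDimensional ℝ E'] in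
theorem dfE_injective (q : M) : Function.Injective (S.dfE q) := S.immersion q

omit [FiniteDimensional ℝ E] [FiniteDimensional ℝ E'] in
theorem etaE_apply (q : M) (v : E) : S.etaE q v =
    Real.cos (S.t q) * K.gE (S.f q) (S.dfE q v) (K.jE (S.f q) (S.nE q)) := rfl

omit [FiniteDimensional ℝ E] [FiniteDimensional ℝ E'] in
theorem phiE_apply (q : M) (v : E) : S.phiE q v = S.tanE q (K.jE (S.f q) (S.dfE q v)
    + S.etaE q v • (Real.cos (S.t q) • S.nE q
      - Real.sin (S.t q) • K.jE (S.f q) (S.nE q))) := rfl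

omit [FiniteDimensional ℝ E] [FiniteDimensional ℝ E'] in
theorem tan_t (q : M) : Real.tan (S.t q) =
    K.gE (S.f q) (S.nE q) (K.jE (S.f q) (S.nE q)) := Real.tan_arctan _

omit [FiniteDimensional ℝ E] [FiniteDimensional ℝ E'] in
theorem cos_t_pos (q : M) : 0 < Real.cos (S.t q) := Real.cos_arctan_pos _

omit [FiniteDimensional ℝ E] [FiniteDimensional ℝ E'] in
theorem sin_t (q : M) : Real.sin (S.t q) = Real.cos (S.t q) *
    K.gE (S.f q) (S.nE q) (K.jE (S.f q) (S.nE q)) := by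
  rw [← tan_t, Real.tan_eq_sin_div_cos, mul_div_cancel₀ _ (S.cos_t_pos q).ne']

variable (hdim : Module.finrank ℝ E' = Module.finrank ℝ E + 1)

include hdim

omit [FiniteDimensional ℝ E] in
theorem eq_zero_of_orthogonal (q : M) {X : E'}
    (h1 : ∀ u, K.gE (S.f q) X (S.dfE q u) = 0) (h2 : K.gE (S.f q) X (S.nE q) = 0) : X = 0 :=
  Norden.eq_zero_of_orthogonal (K.gE_nondeg _) (S.dfE_injective q) (S.gE_nE q) (S.nE_nE q)
    hdim h1 h2

omit [FiniteDimensional ℝ E] in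
theorem gE_nondeg (q : M) (v : E) (h : ∀ w, S.gE q v w = 0) : v = 0 := by
  apply S.dfE_injective q
  rw [map_zero]
  exact S.eq_zero_of_orthogonal hdim q (fun u => h u) (S.gE_nE q v)

theorem gE_tanE (q : M) (w : E') (v : E) :
    S.gE q (S.tanE q w) v = K.gE (S.f q) w (S.dfE q v) := by
  have h := apply_sharp (isInvertible_of_nondegenerate (S.gE_nondeg hdim q))
    ((K.gE (S.f q) w).comp (S.dfE q))
  exact congrArg (fun l => l v) h

theorem dfE_tanE (q : M) {w : E'} (hw : K.gE (S.f q) w (S.nE q) = 0) :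
    S.dfE q (S.tanE q w) = w := by
  rw [← sub_eq_zero]
  refine S.eq_zero_of_orthogonal hdim q (fun u => ?_) ?_
  · rw [map_sub, sub_apply, ← gE_apply, S.gE_tanE hdim, sub_self]
  · rw [map_sub, sub_apply, gE_nE, hw, sub_self]

omit [FiniteDimensional ℝ E] [FiniteDimensional ℝ E'] hdim in
theorem jE_nE_jE_nE (q : M) :
    K.gE (S.f q) (K.jE (S.f q) (S.nE q)) (K.jE (S.f q) (S.nE q)) = 1 := by
  rw [K.gE_jE, nE_nE, neg_neg]

omit [FiniteDimensional ℝ E] [FiniteDimensional ℝ E'] hdim in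
theorem jE_nE_nE (q : M) : K.gE (S.f q) (K.jE (S.f q) (S.nE q)) (S.nE q) =
    K.gE (S.f q) (S.nE q) (K.jE (S.f q) (S.nE q)) := K.gE_symm _ _ _

theorem dfE_xiE (q : M) : S.dfE q (S.xiE q) =
    Real.sin (S.t q) • S.nE q + Real.cos (S.t q) • K.jE (S.f q) (S.nE q) := by
  have h : S.xiE q = S.tanE q
    (Real.sin (S.t q) • S.nE q + Real.cos (S.t q) • K.jE (S.f q) (S.nE q)) := rfl
  rw [h]
  refine S.dfE_tanE hdim q ?_
  simp only [map_add, map_smul, add_apply, smul_apply, smul_eq_mul, nE_nE, jE_nE_nE, sin_t]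
  ring

theorem dfE_phiE (q : M) (v : E) : S.dfE q (S.phiE q v) = K.jE (S.f q) (S.dfE q v)
    + S.etaE q v • (Real.cos (S.t q) • S.nE q
      - Real.sin (S.t q) • K.jE (S.f q) (S.nE q)) := by
  rw [phiE_apply]
  refine S.dfE_tanE hdim q ?_
  simp only [map_add, map_sub, map_smul, add_apply, sub_apply, smul_apply, smul_eq_mul, nE_nE,
    jE_nE_nE, K.jE_self_adjoint (S.f q) (S.dfE q v), etaE_apply]
  have h1 := S.sin_t q
  have h2 := Real.sin_sq_add_cos_sq (S.t q)
  linear_combination (-Real.sin (S.t q) *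
    K.gE (S.f q) (S.dfE q v) (K.jE (S.f q) (S.nE q))) * (-h1) +
    (-K.gE (S.f q) (S.dfE q v) (K.jE (S.f q) (S.nE q))) * h2

theorem etaE_eq (q : M) (v : E) : S.etaE q v = S.gE q v (S.xiE q) := by
  rw [gE_apply, S.dfE_xiE hdim, etaE_apply]
  simp [gE_nE]

theorem etaE_xiE (q : M) : S.etaE q (S.xiE q) = 1 := by
  rw [etaE_apply, S.dfE_xiE hdim]
  simp only [map_add, map_smul, add_apply, smul_apply, smul_eq_mul, jE_nE_jE_nE]
  linear_combination Real.sin_sq_add_cos_sq (S.t q) - Real.sin (S.t q) * S.sin_t q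

/-- The twin form of the ambient metric on tangent vectors. -/
theorem twin_form (q : M) (v w : E) : K.gE (S.f q) (S.dfE q v) (K.jE (S.f q) (S.dfE q w)) =
    S.gE q v (S.phiE q w) + Real.tan (S.t q) * S.etaE q v * S.etaE q w := by
  rw [gE_apply, S.dfE_phiE hdim, tan_t]
  simp only [map_add, map_sub, map_smul, smul_eq_mul, gE_nE]
  simp only [sin_t, etaE_apply]
  ring

theorem isAlmostContact (q : M) : IsAlmostContact (S.gE q) (S.phiE q) (S.etaE q) (S.xiE q) where
  symm := S.gE_symm q
  nondeg := S.gE_nondeg hdim q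
  self_adjoint v w := by
    have h1 := S.twin_form hdim q v w
    have h2 := S.twin_form hdim q w v
    rw [← K.jE_self_adjoint, K.gE_symm] at h2
    rw [S.gE_symm q (S.phiE q v)]
    linear_combination h1 - h2
  sq v := by
    apply S.dfE_injective q
    have h0 : S.etaE q (S.phiE q v) = 0 := by
      rw [etaE_apply, S.dfE_phiE hdim]
      simp only [map_add, map_sub, map_smul, add_apply, sub_apply, smul_apply, smul_eq_mul,
        K.gE_jE, gE_nE, nE_nE]
      rw [sin_t]; ring
    have e : S.dfE q (-v + S.etaE q v • S.xiE q) = -S.dfE q v + S.etaE q v •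
        (Real.sin (S.t q) • S.nE q + Real.cos (S.t q) • K.jE (S.f q) (S.nE q)) := by
      rw [map_add, map_neg, map_smul, S.dfE_xiE hdim]
    rw [e, S.dfE_phiE hdim, h0, S.dfE_phiE hdim]
    simp only [map_add, map_sub, map_smul, K.jE_sq]
    module
  eta := S.etaE_eq hdim q
  unit := S.etaE_xiE hdim q

/-! ### The hypersurface in charts -/

variable [IsManifold 𝓘(ℝ, E) ∞ M] (p : M)

/-- The immersion in the charts at `p` and at its image. -/
def coordMap : E → E' := inCharts S.f p (S.f p)

/-- The normal field in the charts at `p` and at its image. -/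
def coordNormal (y : E) : E' :=
  mfderiv 𝓘(ℝ, E') 𝓘(ℝ, E') (extChartAt 𝓘(ℝ, E') (S.f p))
    (S.f ((extChartAt 𝓘(ℝ, E) p).symm y)) (S.N ((extChartAt 𝓘(ℝ, E) p).symm y))

/-- The coordinate point `y` lies in the chart at `p` and its image lies in the chart at
`f(p)`. -/
def MemCharts (y : E) : Prop := y ∈ (extChartAt 𝓘(ℝ, E) p).target ∧
  S.f ((extChartAt 𝓘(ℝ, E) p).symm y) ∈ (extChartAt 𝓘(ℝ, E') (S.f p)).source

omit hdim [FiniteDimensional ℝ E] [FiniteDimensional ℝ E'] [IsManifold 𝓘(ℝ, E) ∞ M] in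
theorem eventually_memCharts {y : E} (hy : S.MemCharts p y) : ∀ᶠ z in 𝓝 y, S.MemCharts p z :=
  Filter.Eventually.and ((isOpen_extChartAt_target p).mem_nhds hy.1)
    (eventually_mem_source S.smooth_f hy.1 hy.2)

omit hdim [FiniteDimensional ℝ E] [FiniteDimensional ℝ E'] [IsManifold 𝓘(ℝ, E) ∞ M] in
theorem memCharts_self : S.MemCharts p (extChartAt 𝓘(ℝ, E) p p) :=
  ⟨mem_extChartAt_target p, by rw [extChartAt_to_inv]; exact mem_extChartAt_source _⟩

omit hdim [FiniteDimensional ℝ E] [FiniteDimensional ℝ E'] [IsManifold 𝓘(ℝ, E) ∞ M] in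
theorem coordMap_self :
    S.coordMap p (extChartAt 𝓘(ℝ, E) p p) = extChartAt 𝓘(ℝ, E') (S.f p) (S.f p) := by
  rw [coordMap, inCharts, extChartAt_to_inv]

variable {p} {y : E} (hy : S.MemCharts p y)

include hy

omit hdim [FiniteDimensional ℝ E] [FiniteDimensional ℝ E'] [IsManifold 𝓘(ℝ, E) ∞ M] in
theorem coordMap_mem : S.coordMap p y ∈ (extChartAt 𝓘(ℝ, E') (S.f p)).target :=
  (extChartAt 𝓘(ℝ, E') (S.f p)).map_source hy.2

omit hdim [FiniteDimensional ℝ E] [FiniteDimensional ℝ E'] [IsManifold 𝓘(ℝ, E) ∞ M] in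
theorem symm_coordMap : (extChartAt 𝓘(ℝ, E') (S.f p)).symm (S.coordMap p y) =
    S.f ((extChartAt 𝓘(ℝ, E) p).symm y) :=
  (extChartAt 𝓘(ℝ, E') (S.f p)).left_inv hy.2

omit hdim [FiniteDimensional ℝ E] [FiniteDimensional ℝ E'] in
theorem frameE_fderiv_coordMap (v : E) :
    frameE (S.f p) (S.coordMap p y) (fderiv ℝ (S.coordMap p) y v) =
      S.dfE ((extChartAt 𝓘(ℝ, E) p).symm y) (frameE p y v) :=
  frameE_fderiv_inCharts S.smooth_f hy.1 hy.2 v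

omit hdim [FiniteDimensional ℝ E] [FiniteDimensional ℝ E'] [IsManifold 𝓘(ℝ, E) ∞ M] in
theorem frameE_coordNormal : frameE (S.f p) (S.coordMap p y) (S.coordNormal p y) =
    S.nE ((extChartAt 𝓘(ℝ, E) p).symm y) := by
  rw [← frameE_coframeE (S.coordMap_mem hy) (S.nE _)]
  congr 1
  have h : ∀ q q' : M', q = q' → ∀ v : E',
      (mfderiv 𝓘(ℝ, E') 𝓘(ℝ, E') (extChartAt 𝓘(ℝ, E') (S.f p)) q : E' →L[ℝ] E') v =
      (mfderiv 𝓘(ℝ, E') 𝓘(ℝ, E') (extChartAt 𝓘(ℝ, E') (S.f p)) q' : E' →L[ℝ] E') v := by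
    rintro q _ rfl v; rfl
  exact h _ _ (S.symm_coordMap hy).symm _

omit hdim [FiniteDimensional ℝ E] [FiniteDimensional ℝ E'] [IsManifold 𝓘(ℝ, E) ∞ M] in
theorem metric_coordMap (v w : E') : bilinInChart K.g (S.f p) (S.coordMap p y) v w =
    K.gE (S.f ((extChartAt 𝓘(ℝ, E) p).symm y)) (frameE (S.f p) (S.coordMap p y) v)
      (frameE (S.f p) (S.coordMap p y) w) := by
  rw [K.bilinInChart_apply, S.symm_coordMap hy]

omit hdim [FiniteDimensional ℝ E] [FiniteDimensional ℝ E'] [IsManifold 𝓘(ℝ, E) ∞ M] in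
theorem frameE_complex (v : E') :
    frameE (S.f p) (S.coordMap p y) (endoInChart K.J (S.f p) (S.coordMap p y) v) =
    K.jE (S.f ((extChartAt 𝓘(ℝ, E) p).symm y)) (frameE (S.f p) (S.coordMap p y) v) := by
  rw [KahlerNorden.frameE_endoInChart (S.coordMap_mem hy), S.symm_coordMap hy]

omit hdim hy [FiniteDimensional ℝ E] [FiniteDimensional ℝ E'] [IsManifold 𝓘(ℝ, E) ∞ M] in
theorem bilinInChart_apply (v w : E) : bilinInChart S.g p y v w =
    S.gE ((extChartAt 𝓘(ℝ, E) p).symm y) (frameE p y v) (frameE p y w) := rfl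

omit hdim [FiniteDimensional ℝ E] [FiniteDimensional ℝ E'] in
theorem contDiffAt_coordMap : ContDiffAt ℝ ∞ (S.coordMap p) y :=
  contDiffAt_inCharts S.smooth_f hy.1 hy.2

omit hdim [FiniteDimensional ℝ E] [FiniteDimensional ℝ E'] in
theorem contDiffAt_coordNormal : ContDiffAt ℝ ∞ (S.coordNormal p) y := by
  have hM' : IsManifold 𝓘(ℝ, E') 1 M' := IsManifold.of_le (n := ∞) (by simp)
  set e := trivializationAt E' (TangentSpace 𝓘(ℝ, E') : M' → Type _) (S.f p) with he
  have hsrc : ∀ z, S.MemCharts p z →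
      S.f ((extChartAt 𝓘(ℝ, E) p).symm z) ∈ (chartAt E' (S.f p)).source := fun z hz => by
    simpa using hz.2
  have h1 : ContMDiffAt 𝓘(ℝ, E) 𝓘(ℝ, E') ∞
      (fun q => (e (⟨S.f q, S.N q⟩ : TangentBundle 𝓘(ℝ, E') M')).2)
      ((extChartAt 𝓘(ℝ, E) p).symm y) := by
    refine ((e.contMDiffAt_iff ?_).1 (S.smooth_N _)).2
    rw [e.mem_source, he, TangentBundle.trivializationAt_baseSet]
    exact hsrc y hy
  have h2 : ContMDiffAt 𝓘(ℝ, E) 𝓘(ℝ, E) ∞ (extChartAt 𝓘(ℝ, E) p).symm y :=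
    (contMDiffOn_extChartAt_symm p).contMDiffAt ((isOpen_extChartAt_target p).mem_nhds hy.1)
  have h3 := contMDiffAt_iff_contDiffAt.1 (h1.comp y h2)
  refine h3.congr_of_eventuallyEq ?_
  filter_upwards [S.eventually_memCharts p hy] with z hz
  have h4 := TangentBundle.continuousLinearMapAt_trivializationAt (𝕜 := ℝ) (I := 𝓘(ℝ, E'))
    (hsrc z hz)
  have h5 : S.f ((extChartAt 𝓘(ℝ, E) p).symm z) ∈ e.baseSet := by
    rw [he, TangentBundle.trivializationAt_baseSet]
    exact hsrc z hz
  have h6 := congrArg (fun L => L (S.N ((extChartAt 𝓘(ℝ, E) p).symm z))) h4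
  rw [coordNormal]
  refine h6.symm.trans ?_
  rw [Bundle.Trivialization.continuousLinearMapAt_apply]
  exact congrFun (Bundle.Trivialization.coe_linearMapAt_of_mem (R := ℝ) e h5) _

theorem isHypersurfaceNear : IsHypersurfaceNear (bilinInChart S.g p)
    (bilinInChart K.g (S.f p)) (S.coordMap p) (S.coordNormal p) y := by
  have hev := S.eventually_memCharts p hy
  have hpull : ∀ᶠ z in 𝓝 y, ∀ v w, bilinInChart S.g p z v w =
      bilinInChart K.g (S.f p) (S.coordMap p z) (fderiv ℝ (S.coordMap p) z v)
        (fderiv ℝ (S.coordMap p) z w) := by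
    filter_upwards [hev] with z hz v w
    rw [S.metric_coordMap hz, S.frameE_fderiv_coordMap hz, S.frameE_fderiv_coordMap hz]
    rfl
  refine ⟨⟨⟨?_, ?_, ?_⟩, ?_, ?_, hpull⟩, ?_, ?_, ?_, ?_⟩
  · filter_upwards [hev, hpull.eventually_nhds] with z hz hp
    have hh := S.contDiffAt_coordMap hz
    have h1 : ContDiffAt ℝ ∞ (fun x => bilinInChart K.g (S.f p) (S.coordMap p x)) z :=
      (KahlerNorden.isMetricNear (S.coordMap_mem hz)).smooth.self_of_nhds.comp z hh
    refine (h1.bilinearComp hh.fderiv_infty hh.fderiv_infty).congr_of_eventuallyEq ?_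
    filter_upwards [hp] with x hx
    ext v w
    exact hx v w
  · exact Eventually.of_forall fun z v w =>
      S.gE_symm ((extChartAt 𝓘(ℝ, E) p).symm z) (frameE p z v) (frameE p z w)
  · filter_upwards [hev] with z hz
    refine isInvertible_of_nondegenerate fun v hv => ?_
    have h1 : frameE p z v = 0 := by
      refine S.gE_nondeg hdim ((extChartAt 𝓘(ℝ, E) p).symm z) _ fun w => ?_
      rw [← frameE_coframeE hz.1 w, ← bilinInChart_apply, hv]
    rw [← coframeE_frameE hz.1 v, h1, map_zero]
  · exact KahlerNorden.isMetricNear (S.coordMap_mem hy)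
  · filter_upwards [hev] with z hz using S.contDiffAt_coordMap hz
  · filter_upwards [hev] with z hz using S.contDiffAt_coordNormal hz
  · filter_upwards [hev] with z hz v
    rw [S.metric_coordMap hz, S.frameE_fderiv_coordMap hz, S.frameE_coordNormal hz, S.gE_nE]
  · filter_upwards [hev] with z hz
    rw [S.metric_coordMap hz, S.frameE_coordNormal hz, S.nE_nE]
  · filter_upwards [hev] with z hz X h1 h2
    have h3 : frameE (S.f p) (S.coordMap p z) X = 0 := by
      refine S.eq_zero_of_orthogonal hdim ((extChartAt 𝓘(ℝ, E) p).symm z) (fun u => ?_) ?_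
      · have := h1 (coframeE p z u)
        rwa [S.metric_coordMap hz, S.frameE_fderiv_coordMap hz, frameE_coframeE hz.1] at this
      · rwa [S.metric_coordMap hz, S.frameE_coordNormal hz] at h2
    rw [← coframeE_frameE (S.coordMap_mem hz) X, h3, map_zero]

omit hdim [FiniteDimensional ℝ E] [FiniteDimensional ℝ E'] [IsManifold 𝓘(ℝ, E) ∞ M] in
theorem normalSlope_eq : normalSlope (bilinInChart K.g (S.f p)) (endoInChart K.J (S.f p))
    (S.coordMap p) (S.coordNormal p) y = Real.tan (S.t ((extChartAt 𝓘(ℝ, E) p).symm y)) := by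
  rw [normalSlope, S.metric_coordMap hy, S.frameE_complex hy, S.frameE_coordNormal hy, tan_t]

omit hdim [FiniteDimensional ℝ E] [FiniteDimensional ℝ E'] in
theorem normalForm_eq (v : E) : normalForm (bilinInChart K.g (S.f p)) (endoInChart K.J (S.f p))
    (S.coordMap p) (S.coordNormal p) y v =
      S.etaE ((extChartAt 𝓘(ℝ, E) p).symm y) (frameE p y v)
        / Real.cos (S.t ((extChartAt 𝓘(ℝ, E) p).symm y)) := by
  rw [normalForm, S.metric_coordMap hy, S.frameE_complex hy, S.frameE_coordNormal hy,
    S.frameE_fderiv_coordMap hy, etaE_apply, mul_div_cancel_left₀ _ (S.cos_t_pos _).ne']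

theorem bilinInChart_phi (w z : E) : bilinInChart S.g p y (endoInChart S.φ p y w) z =
      bilinInChart K.g (S.f p) (S.coordMap p y) (endoInChart K.J (S.f p) (S.coordMap p y)
        (fderiv ℝ (S.coordMap p) y w)) (fderiv ℝ (S.coordMap p) y z)
        - normalSlope (bilinInChart K.g (S.f p)) (endoInChart K.J (S.f p))
            (S.coordMap p) (S.coordNormal p) y
          / (1 + normalSlope (bilinInChart K.g (S.f p)) (endoInChart K.J (S.f p))
            (S.coordMap p) (S.coordNormal p) y ^ 2)
          * normalForm (bilinInChart K.g (S.f p)) (endoInChart K.J (S.f p))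
            (S.coordMap p) (S.coordNormal p) y w
          * normalForm (bilinInChart K.g (S.f p)) (endoInChart K.J (S.f p))
            (S.coordMap p) (S.coordNormal p) y z := by
  have h1 : frameE p y (endoInChart S.φ p y w) =
      S.phiE ((extChartAt 𝓘(ℝ, E) p).symm y) (frameE p y w) := frameE_coframeE hy.1 _
  have h2 := (S.cos_t_pos ((extChartAt 𝓘(ℝ, E) p).symm y)).ne'
  rw [bilinInChart_apply, h1, S.normalSlope_eq hy, S.normalForm_eq hy, S.normalForm_eq hy,
    S.metric_coordMap hy, S.frameE_complex hy, S.frameE_fderiv_coordMap hy,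
    S.frameE_fderiv_coordMap hy, K.jE_self_adjoint, S.twin_form hdim,
    (S.isAlmostContact hdim _).self_adjoint, div_eq_mul_inv _ (1 + _), Real.inv_one_add_tan_sq h2]
  field_simp
  ring

end TimelikeHypersurface

namespace TimelikeHypersurface

variable {E' : Type*} [NormedAddCommGroup E'] [NormedSpace ℝ E'] [FiniteDimensional ℝ E']
  {M' : Type*} [TopologicalSpace M'] [ChartedSpace E' M'] [IsManifold 𝓘(ℝ, E') ∞ M']
  {K : KahlerNorden E' M'}
  {E : Type*} [NormedAddCommGroup E] [NormedSpace ℝ E] [FiniteDimensional ℝ E]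
  {M : Type*} [TopologicalSpace M] [ChartedSpace E M] [IsManifold 𝓘(ℝ, E) ∞ M]
  (S : TimelikeHypersurface K E M)
  (hdim : Module.finrank ℝ E' = Module.finrank ℝ E + 1) (p : M)

/-! ### The shape operator -/

omit [FiniteDimensional ℝ E] [FiniteDimensional ℝ E'] in
theorem bilinInChart_self : bilinInChart S.g p (extChartAt 𝓘(ℝ, E) p p) = S.gE p := by
  ext v w
  rw [bilinInChart_apply, frameE_self, frameE_self, extChartAt_to_inv]

/-- The shape operator `A` of the normal `N`: `∇'_v N = -A v`. -/
def shape : E →L[ℝ] E :=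
  -(S.tanE p).comp (fderiv ℝ (S.coordNormal p) (extChartAt 𝓘(ℝ, E) p p) +
    ((christoffelL (bilinInChart K.g (S.f p)) (extChartAt 𝓘(ℝ, E') (S.f p) (S.f p))).flip
      (S.nE p)).comp (S.dfE p))

omit [FiniteDimensional ℝ E] [FiniteDimensional ℝ E'] in
theorem fderiv_coordMap_self (v : E) :
    fderiv ℝ (S.coordMap p) (extChartAt 𝓘(ℝ, E) p p) v = S.dfE p v := by
  have h := S.frameE_fderiv_coordMap (S.memCharts_self p) v
  rwa [coordMap_self, frameE_self, frameE_self, extChartAt_to_inv] at h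

omit [FiniteDimensional ℝ E] [FiniteDimensional ℝ E'] [IsManifold 𝓘(ℝ, E) ∞ M] in
theorem coordNormal_self : S.coordNormal p (extChartAt 𝓘(ℝ, E) p p) = S.nE p := by
  have h := S.frameE_coordNormal (S.memCharts_self p)
  rwa [coordMap_self, frameE_self, extChartAt_to_inv] at h

omit [FiniteDimensional ℝ E] [FiniteDimensional ℝ E'] in
theorem endoInChart_phi_self : endoInChart S.φ p (extChartAt 𝓘(ℝ, E) p p) = S.phiE p := by
  ext w
  have h : frameE p (extChartAt 𝓘(ℝ, E) p p) (endoInChart S.φ p (extChartAt 𝓘(ℝ, E) p p) w) =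
      S.phiE ((extChartAt 𝓘(ℝ, E) p).symm (extChartAt 𝓘(ℝ, E) p p))
        (frameE p (extChartAt 𝓘(ℝ, E) p p) w) := frameE_coframeE (mem_extChartAt_target p) _
  rwa [frameE_self, frameE_self, extChartAt_to_inv] at h

include hdim

theorem normalDeriv_eq (v : E) : normalDeriv (bilinInChart K.g (S.f p)) (S.coordMap p)
    (S.coordNormal p) (extChartAt 𝓘(ℝ, E) p p) v =
      -fderiv ℝ (S.coordMap p) (extChartAt 𝓘(ℝ, E) p p) (S.shape p v) := by
  have h1 := (S.isHypersurfaceNear hdim (S.memCharts_self p)).normalDeriv_normal v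
  rw [coordMap_self, coordNormal_self, K.bilinInChart_self] at h1
  have h2 : S.shape p v = -S.tanE p (normalDeriv (bilinInChart K.g (S.f p)) (S.coordMap p)
      (S.coordNormal p) (extChartAt 𝓘(ℝ, E) p p) v) := by
    rw [normalDeriv, coordMap_self, coordNormal_self, fderiv_coordMap_self]
    rfl
  rw [fderiv_coordMap_self, h2, map_neg, S.dfE_tanE hdim p h1, neg_neg]

theorem secondForm_eq (v w : E) : secondForm (bilinInChart K.g (S.f p)) (S.coordMap p)
    (S.coordNormal p) (extChartAt 𝓘(ℝ, E) p p) v w = -S.gE p (S.shape p v) w := by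
  rw [← (S.isHypersurfaceNear hdim (S.memCharts_self p)).normalDeriv_tangential,
    S.normalDeriv_eq hdim, fderiv_coordMap_self, fderiv_coordMap_self, coordMap_self,
    K.bilinInChart_self, gE_apply]
  simp

theorem shape_self_adjoint (v w : E) : S.gE p (S.shape p v) w = S.gE p v (S.shape p w) := by
  have h := (S.isHypersurfaceNear hdim (S.memCharts_self p)).secondForm_comm v w
  rw [S.secondForm_eq hdim, S.secondForm_eq hdim] at h
  rw [S.gE_symm p v]
  linarith

omit hdim [FiniteDimensional ℝ E'] [FiniteDimensional ℝ E] [IsManifold 𝓘(ℝ, E) ∞ M] in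
theorem selfAdjoint_chart (x y : E') :
    bilinInChart K.g (S.f p) (S.coordMap p (extChartAt 𝓘(ℝ, E) p p))
      (endoInChart K.J (S.f p) (S.coordMap p (extChartAt 𝓘(ℝ, E) p p)) x) y =
    bilinInChart K.g (S.f p) (S.coordMap p (extChartAt 𝓘(ℝ, E) p p)) x
      (endoInChart K.J (S.f p) (S.coordMap p (extChartAt 𝓘(ℝ, E) p p)) y) := by
  rw [coordMap_self, K.bilinInChart_self, K.endoInChart_self, K.jE_self_adjoint]

theorem F_eq (x y z : E) : S.F p x y z =
    S.gE p (-Real.cos (S.t p) • S.shape p x + Real.sin (S.t p) • S.phiE p (S.shape p x)) y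
        * S.etaE p z
      + S.gE p (-Real.cos (S.t p) • S.shape p x + Real.sin (S.t p) • S.phiE p (S.shape p x)) z
        * S.etaE p y
      + 2 * Real.cos (S.t p) * S.etaE p (S.shape p x) * S.etaE p y * S.etaE p z := by
  have hmem := S.memCharts_self p
  have h := (S.isHypersurfaceNear hdim hmem).coordCovDeriv_induced
    (KahlerNorden.contDiffAt_endoInChart (S.coordMap_mem hmem))
    (KahlerNorden.coordCovDeriv_eq_zero (S.coordMap_mem hmem)) (S.selfAdjoint_chart p)
    (S.normalDeriv_eq hdim p x) (Φ := endoInChart S.φ p)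
    (by
      filter_upwards [S.eventually_memCharts p hmem] with z hz w u
      exact S.bilinInChart_phi hdim hz w u)
    (S.normalSlope_eq hmem).symm (funext fun v => (S.normalForm_eq hmem v).symm) y z
  simp only [frameE_self, extChartAt_to_inv] at h
  rw [bilinInChart_self, endoInChart_phi_self] at h
  have hF : S.F p x y z = S.gE p (coordCovDeriv (bilinInChart S.g p) (endoInChart S.φ p)
    (extChartAt 𝓘(ℝ, E) p p) x y) z := rfl
  have hc := (S.cos_t_pos p).ne'
  have hinv : 1 + Real.tan (S.t p) ^ 2 = (Real.cos (S.t p) ^ 2)⁻¹ := by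
    rw [← Real.inv_one_add_tan_sq hc, inv_inv]
  rw [hF, h, hinv, Real.tan_eq_sin_div_cos]
  simp only [map_add, map_smul, add_apply, smul_apply, smul_eq_mul]
  field_simp

/-- `dt(x) = -2 cos t η(A x)`. -/
theorem dtξ_eq : S.dtξ p = -2 * Real.cos (S.t p) * S.etaE p (S.shape p (S.xiE p)) := by
  have hmem := S.memCharts_self p
  set a := extChartAt 𝓘(ℝ, E) p p with ha
  have hslope := (S.isHypersurfaceNear hdim hmem).hasLineDerivAt_normalSlope
    (KahlerNorden.contDiffAt_endoInChart (S.coordMap_mem hmem))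
    (KahlerNorden.coordCovDeriv_eq_zero (S.coordMap_mem hmem)) (S.selfAdjoint_chart p)
    (S.normalDeriv_eq hdim p (S.xiE p))
  rw [S.normalForm_eq hmem, frameE_self, extChartAt_to_inv] at hslope
  set σ := normalSlope (bilinInChart K.g (S.f p)) (endoInChart K.J (S.f p)) (S.coordMap p)
    (S.coordNormal p) with hσ
  have hσa : σ a = Real.tan (S.t p) := by
    rw [hσ, S.normalSlope_eq hmem, extChartAt_to_inv]
  have hdiff : DifferentiableAt ℝ σ a :=
    ((S.isHypersurfaceNear hdim hmem).contDiffAt_normalSlope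
      (KahlerNorden.contDiffAt_endoInChart (S.coordMap_mem hmem))).differentiableAt (by simp)
  have harctan := hdiff.hasFDerivAt.arctan
  have hchart : ∀ y, S.MemCharts p y →
      S.t ((extChartAt 𝓘(ℝ, E) p).symm y) = Real.arctan (σ y) := fun y hy => by
    rw [hσ, S.normalSlope_eq hy, tan_t]
    rfl
  have hmd : MDifferentiableAt 𝓘(ℝ, E) 𝓘(ℝ, ℝ) S.t p := by
    have hM : IsManifold 𝓘(ℝ, E) 1 M := IsManifold.of_le (n := ∞) (by simp)
    have h1 : MDifferentiableAt 𝓘(ℝ, E) 𝓘(ℝ, E) (extChartAt 𝓘(ℝ, E) p) p :=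
      mdifferentiableAt_extChartAt (mem_chart_source E p)
    have h2 : MDifferentiableAt 𝓘(ℝ, E) 𝓘(ℝ, ℝ) (fun y => Real.arctan (σ y))
        (extChartAt 𝓘(ℝ, E) p p) := harctan.differentiableAt.mdifferentiableAt
    refine (h2.comp p h1).congr_of_eventuallyEq ?_
    filter_upwards [(continuousAt_extChartAt p).eventually (S.eventually_memCharts p hmem),
      extChartAt_source_mem_nhds (I := 𝓘(ℝ, E)) p] with q hq hqs
    rw [Function.comp_apply, ← hchart _ hq, (extChartAt 𝓘(ℝ, E) p).left_inv hqs]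
  have hd : S.dtξ p = fderiv ℝ (fun y => Real.arctan (σ y)) a (S.xiE p) := by
    have h1 : (mfderiv 𝓘(ℝ, E) 𝓘(ℝ, ℝ) S.t p : E →L[ℝ] ℝ) =
        fderiv ℝ (fun y => Real.arctan (σ y)) a := by
      rw [hmd.mfderiv, ModelWithCorners.range_eq_univ, fderivWithin_univ]
      refine Filter.EventuallyEq.fderiv_eq ?_
      filter_upwards [S.eventually_memCharts p hmem] with y hy using hchart y hy
    exact congrArg (fun L : E →L[ℝ] ℝ => L (S.xiE p)) h1
  have hc := (S.cos_t_pos p).ne'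
  rw [hd, harctan.fderiv, smul_apply, hdiff.hasFDerivAt.hasLineDerivAt (S.xiE p) |>.unique hslope,
    hσa, one_div, Real.inv_one_add_tan_sq hc, smul_eq_mul]
  field_simp

/-- The Gauss equation for the hypersurface. -/
theorem gauss_equation (x y z u : E) : S.R p x y z u =
    K.gE (S.f p) (coordCurvature (bilinInChart K.g (S.f p))
      (extChartAt 𝓘(ℝ, E') (S.f p) (S.f p)) (S.dfE p x) (S.dfE p y) (S.dfE p z)) (S.dfE p u)
    - (S.gE p (S.shape p y) z * S.gE p (S.shape p x) u
      - S.gE p (S.shape p x) z * S.gE p (S.shape p y) u) := by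
  have h := (S.isHypersurfaceNear hdim (S.memCharts_self p)).gauss x y z u
  simp only [S.secondForm_eq hdim, fderiv_coordMap_self] at h
  rw [coordMap_self, K.bilinInChart_self, bilinInChart_self] at h
  have hR : S.R p x y z u = S.gE p (coordCurvature (bilinInChart S.g p)
    (extChartAt 𝓘(ℝ, E) p p) x y z) u := rfl
  rw [hR]
  linear_combination -h

/-- The curvature tensor of a hypersurface of class `F₄ ⊕ F₅` in a Kähler-Norden manifold of
constant totally real sectional curvatures. -/
theorem R_eq {n : ℕ} (hn : 1 ≤ n) (hnE : Module.finrank ℝ E = 2 * n + 1) {ν νt : M' → ℝ}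
    (hK : K.HasConstantTotallyRealCurvatures ν νt) (hS : S.IsF4F5 n) {c s a b P Q : ℝ}
    (hc : c = Real.cos (S.t p)) (hs : s = Real.sin (S.t p))
    (ha : a = S.θ p (S.ξ p) / (2 * n)) (hb : b = S.θs p (S.ξ p) / (2 * n))
    (hP : P = a * c + b * s) (hQ : Q = a * s - b * c) :
    S.R p = piSum (S.gE p) (S.phiE p) (S.etaE p) (ν (S.f p) - P ^ 2) (-ν (S.f p) - Q ^ 2)
      (νt (S.f p) + P * Q)
      (-νt (S.f p) * Real.tan (S.t p) - S.dtξ p / (2 * c) * P + P ^ 2)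
      (-ν (S.f p) * Real.tan (S.t p) - S.dtξ p / (2 * c) * Q + P * Q) := by
  have hac := S.isAlmostContact hdim p
  have hA := hac.shape_operator (S.shape_self_adjoint hdim p)
    (by rw [add_comm]; exact Real.sin_sq_add_cos_sq (S.t p)) (S.F_eq hdim p)
    (a := a) (b := b) (fun x y z => by rw [ha, hb]; exact hS p x y z)
  rw [← hc, ← hs, ← hP, ← hQ] at hA
  have hκ : S.etaE p (S.shape p (S.xiE p)) = -(S.dtξ p / (2 * c)) := by
    have := S.cos_t_pos p
    rw [S.dtξ_eq hdim, hc]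
    field_simp
  rw [hκ] at hA
  funext x y z u
  have key := hac.gauss_formula hA (H := fun x y =>
    K.gE (S.f p) (S.dfE p x) (K.jE (S.f p) (S.dfE p y))) (S.twin_form hdim p)
    (R := S.R p) (ν := ν (S.f p)) (νt := νt (S.f p)) (fun x y z u => by
      rw [S.gauss_equation hdim, KahlerNorden.curvature4_eq (by omega) hK]
      simp only [pi1, pi2, pi3, gE_apply]) x y z u
  rw [key]
  congr 1 <;> ring

end TimelikeHypersurface

end Norden

end

open Norden in
theorem corollary3p1 (n : ℕ) (hn : 1 ≤ n)
    {M' : Type*} [TopologicalSpace M']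
    [ChartedSpace (EuclideanSpace ℝ (Fin (2 * n + 2))) M']
    [IsManifold 𝓘(ℝ, EuclideanSpace ℝ (Fin (2 * n + 2))) ∞ M']
    (K : KahlerNorden (EuclideanSpace ℝ (Fin (2 * n + 2))) M')
    (ν νt : M' → ℝ) (hK : K.HasConstantTotallyRealCurvatures ν νt)
    {M : Type*} [TopologicalSpace M]
    [ChartedSpace (EuclideanSpace ℝ (Fin (2 * n + 1))) M]
    [IsManifold 𝓘(ℝ, EuclideanSpace ℝ (Fin (2 * n + 1))) ∞ M]
    (S : TimelikeHypersurface K (EuclideanSpace ℝ (Fin (2 * n + 1))) M)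
    (hS : S.IsF4F5 n) (p : M) :
    let E := EuclideanSpace ℝ (Fin (2 * n + 1))
    let g : E →L[ℝ] E →L[ℝ] ℝ := S.g p
    let φ : E →L[ℝ] E := S.φ p
    let η : E →L[ℝ] ℝ := S.η p
    let ν₀ : ℝ := ν (S.f p)
    let νt₀ : ℝ := νt (S.f p)
    let t : ℝ := S.t p
    let dtξ : ℝ := S.dtξ p
    let θξ : ℝ := S.θ p (S.ξ p)
    let θsξ : ℝ := S.θs p (S.ξ p)
    (∀ x y z u : E, S.R p x y z u =
      ν₀ * (pi1 g x y z u - pi2 g φ x y z u - Real.tan t * pi5 g φ η x y z u)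
      + νt₀ * (pi3 g φ x y z u - Real.tan t * pi4 g η x y z u)
      - dtξ / (4 * n * Real.cos t) *
          (θξ * (Real.sin t * pi5 g φ η x y z u + Real.cos t * pi4 g η x y z u)
            + θsξ * (Real.sin t * pi4 g η x y z u - Real.cos t * pi5 g φ η x y z u))
      - (θξ ^ 2 + θsξ ^ 2) / (4 * n ^ 2) * pi2 g φ x y z u
      - (θξ * Real.cos t + θsξ * Real.sin t) ^ 2 / (4 * n ^ 2) *
          (pi1 g x y z u - pi2 g φ x y z u - pi4 g η x y z u)
      + (θξ * Real.cos t + θsξ * Real.sin t) * (θξ * Real.sin t - θsξ * Real.cos t)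
          / (4 * n ^ 2) * (pi3 g φ x y z u + pi5 g φ η x y z u))
    ∧ S.τ p =
      4 * n * (n * ν₀ - νt₀ * Real.tan t) - dtξ * θξ - dtξ * θsξ * Real.tan t
      - (n - 1) / n * (θξ * Real.cos t + θsξ * Real.sin t) ^ 2
      - (θξ ^ 2 + θsξ ^ 2) / (2 * n)
    ∧ S.τt p =
      2 * n * (2 * n - 1) * νt₀ + 2 * n * ν₀ * Real.tan t
      + dtξ * θξ / 2 * Real.tan t - dtξ * θsξ / 2
      + (n - 1) / n * (θξ * Real.sin t - θsξ * Real.cos t)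
          * (θξ * Real.cos t + θsξ * Real.sin t)
    ∧ (∀ x y : E, IsNondegenerateSection g x y → IsHolomorphicSection φ x y →
        S.k p x y = -(θξ ^ 2 + θsξ ^ 2) / (4 * n ^ 2))
    ∧ (∀ x y : E, IsNondegenerateSection g x y → IsTotallyRealSection g φ x y →
        η x = 0 → η y = 0 →
        S.k p x y = ν₀ - (θξ * Real.cos t + θsξ * Real.sin t) ^ 2 / (4 * n ^ 2)) := by
  intro E g φ η ν₀ νt₀ t dtξ θξ θsξ
  have hnE : Module.finrank ℝ (EuclideanSpace ℝ (Fin (2 * n + 1))) = 2 * n + 1 := by simp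
  have hdim : Module.finrank ℝ (EuclideanSpace ℝ (Fin (2 * n + 2))) =
      Module.finrank ℝ (EuclideanSpace ℝ (Fin (2 * n + 1))) + 1 := by simp
  have hn0 : (n : ℝ) ≠ 0 := by positivity
  have hc : Real.cos t ≠ 0 := (S.cos_t_pos p).ne'
  have hac : IsAlmostContact g φ η (S.ξ p) := S.isAlmostContact hdim p
  -- on `ker η` the shape operator is `-P - Q φ`
  obtain ⟨P, hP⟩ : ∃ P, P = θξ / (2 * n) * Real.cos t + θsξ / (2 * n) * Real.sin t := ⟨_, rfl⟩
  obtain ⟨Q, hQ⟩ : ∃ Q, Q = θξ / (2 * n) * Real.sin t - θsξ / (2 * n) * Real.cos t := ⟨_, rfl⟩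
  have hR : S.R p = piSum g φ η (ν₀ - P ^ 2) (-ν₀ - Q ^ 2) (νt₀ + P * Q)
      (-νt₀ * Real.tan t - dtξ / (2 * Real.cos t) * P + P ^ 2)
      (-ν₀ * Real.tan t - dtξ / (2 * Real.cos t) * Q + P * Q) :=
    S.R_eq hdim p hn hnE hK hS rfl rfl rfl rfl hP hQ
  have hcs := Real.sin_sq_add_cos_sq t
  have htan : Real.tan t = Real.sin t / Real.cos t := Real.tan_eq_sin_div_cos t
  refine ⟨fun x y z u => ?_, ?_, ?_, fun x y hxy hφ => ?_, fun x y hxy hφ hx hy => ?_⟩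
  · rw [hR]
    unfold piSum
    -- the coefficient of `π₂` is `P ^ 2 + Q ^ 2` up to sign, which needs `sin² t + cos² t = 1`
    have h2 : (θξ ^ 2 + θsξ ^ 2) = (θξ ^ 2 + θsξ ^ 2) * (Real.sin t ^ 2 + Real.cos t ^ 2) := by
      rw [hcs, mul_one]
    rw [h2, hP, hQ]
    field_simp
    ring
  · have h1 : S.τ p = scalar g (S.R p) := rfl
    rw [h1, hR, hac.scalar_piSum hnE, htan]
    have h2 : (θξ ^ 2 + θsξ ^ 2) = (θξ ^ 2 + θsξ ^ 2) * (Real.sin t ^ 2 + Real.cos t ^ 2) := by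
      rw [hcs, mul_one]
    rw [h2, hP, hQ]
    field_simp
    ring
  · have h1 : S.τt p = scalar g (fun x y z u => S.R p x y z (φ u)) := rfl
    rw [h1, hR, hac.scalar_piSum_phi hnE, htan, hP, hQ]
    field_simp
    ring
  · have h1 : S.k p x y = sectional g x y (S.R p) := rfl
    rw [h1, hR, hac.sectional_piSum_holomorphic _ _ _ _ _ hxy hφ]
    have h2 : (θξ ^ 2 + θsξ ^ 2) = (θξ ^ 2 + θsξ ^ 2) * (Real.sin t ^ 2 + Real.cos t ^ 2) := by
      rw [hcs, mul_one]
    rw [h2, hP, hQ]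
    field_simp
    ring
  · have h1 : S.k p x y = sectional g x y (S.R p) := rfl
    rw [h1, hR, hac.sectional_piSum_totallyReal _ _ _ _ _ hxy hφ hx hy, hP]
    field_simp
    ring
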